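/- Let $n\ge 1$, let $d\mu(z)=(2\pi)^{-n}e^{-|z|^2/2}\,dz$ on $\mathbb C^n$ (with $|z|$ the Euclidean norm and $dz$ Lebesgue measure), and let $\mathcal F(\mathbb C^n)$ be the Fock space of entire functions on $\mathbb C^n$ belonging to $L^2(\mathbb C^n,d\mu)$, with the norm of $L^2(\mathbb C^n,d\mu)$. For $\alpha\in\mathbb N^n$ (where $0\in\mathbb N$) put $\zeta_\alpha(z)=z^\alpha/(2^{|\alpha|/2}(\alpha!)^{1/2})$. Let $g:\mathbb C^n\to\mathbb C$ be a Lebesgue measurable radial function (that is, $g(z)$ depends only on $|z|$) such that $g\zeta_\alpha\in L^2(\mathbb C^n,d\mu)$ for all $\alpha\in\mathbb N^n$. Let $T_g$ be the Toeplitz operator $$T_gf(z)=P(gf)(z)=\int_{\mathbb C^n}g(w)f(w)e^{z\cdot\bar w/2}\,d\mu(w),$$ where $P$ is the orthogonal projection of $L^2(\mathbb C^n,d\mu)$ onto $\mathcal F(\mathbb C^n)$, defined on the dense subspace of all $f\in\mathcal F(\mathbb C^n)$ with $gf\in L^2(\mathbb C^n,d\mu)$. Let $q_t(z)=(4\pi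 t)^{-n}e^{-|z|^2/(4t)}$ and $\varphi_k(z)=L_k^{n-1}(\tfrac12|z|^2)e^{-|z|^2/4}$, where $L_k^{n-1}$ is the Laguerre polynomial of degree $k$ and type $n-1$. Then the integrals defining $g*q_{1/4}(w)$, $w\in\mathbb C^n$, and $$\frac{k!\,(n-1)!}{(k+n-1)!}\int_{\mathbb C^n}(g*q_{1/4})(w)\,\varphi_k(2w)\,dw,\qquad k=0,1,2,\dots,$$ converge absolutely, and $T_g$ is bounded on $\mathcal F(\mathbb C^n)$ (that is, there is a constant $C$ with $\|T_gf\|\le C\|f\|$ for all $f$ in its domain) if and only if this sequence is bounded in $k$. -/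

import Mathlib

open MeasureTheory
open scoped Nat NNReal ENNReal ComplexConjugate

noncomputable section

/-- The square `|z|² = |z₁|² + ⋯ + |zₙ|²` of the Euclidean norm on `ℂⁿ`. Here `ℂⁿ` is `Fin n → ℂ`,
whose `volume` is Lebesgue measure; the norm Lean puts on that type (the sup norm) is not used,
except for its topology. -/
def absSq {n : ℕ} (z : Fin n → ℂ) : ℝ := ∑ i, ‖z i‖ ^ 2

/-- The Hermitian product `z · w̄ = ∑ zᵢ w̄ᵢ`. -/
def hermProd {n : ℕ} (z w : Fin n → ℂ) : ℂ := ∑ i, z i * conj (w i)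

/-- A function on `ℂⁿ` is radial if its value at `z` depends on `|z|` only. -/
def IsRadial {n : ℕ} (g : (Fin n → ℂ) → ℂ) : Prop :=
  ∀ z w : Fin n → ℂ, absSq z = absSq w → g z = g w

/-- The Gaussian measure `dμ(z) = (2π)⁻ⁿ exp(-|z|²/2) dz` on `ℂⁿ`. -/
def fockMeasure (n : ℕ) : Measure (Fin n → ℂ) :=
  volume.withDensity fun z => ENNReal.ofReal (((2 * Real.pi) ^ n)⁻¹ * Real.exp (-(absSq z) / 2))

/-- The Fock space: entire functions on `ℂⁿ` that are square integrable with respect to `μ`. -/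
def fockSpace (n : ℕ) : Submodule ℂ ((Fin n → ℂ) → ℂ) where
  carrier := {f | Differentiable ℂ f ∧ MemLp f 2 (fockMeasure n)}
  add_mem' := fun ha hb => ⟨ha.1.add hb.1, ha.2.add hb.2⟩
  zero_mem' := ⟨differentiable_const (0 : ℂ), MemLp.zero⟩
  smul_mem' := fun c _ hf => ⟨hf.1.const_smul c, hf.2.const_smul c⟩

/-- The normalized monomials `ζ_α(z) = z^α / (2^{|α|/2} (α!)^{1/2})`. -/
def fockMonomial {n : ℕ} (α : Fin n → ℕ) (z : Fin n → ℂ) : ℂ :=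
  (∏ i, z i ^ α i) / ((√(2 ^ (∑ i, α i)) * √((∏ i, (α i)! : ℕ) : ℝ) : ℝ) : ℂ)

/-- The orthogonal projection of `L²(ℂⁿ, dμ)` onto the Fock space, given by integration against
the reproducing kernel `K(z,w) = exp(z · w̄ / 2)`. -/
def fockProj {n : ℕ} (u : (Fin n → ℂ) → ℂ) (z : Fin n → ℂ) : ℂ :=
  ∫ w, u w * Complex.exp (hermProd z w / 2) ∂(fockMeasure n)

/-- The Toeplitz operator `T_g f (z) = P(g f)(z) = ∫ g(w) f(w) exp(z · w̄ / 2) dμ(w)`. -/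
def toeplitz {n : ℕ} (g f : (Fin n → ℂ) → ℂ) : (Fin n → ℂ) → ℂ :=
  fockProj fun w => g w * f w

/-- The natural domain of `T_g`: all `f` in the Fock space with `g f ∈ L²(ℂⁿ, dμ)`. -/
def toeplitzDomain {n : ℕ} (g : (Fin n → ℂ) → ℂ) : Set ((Fin n → ℂ) → ℂ) :=
  {f | f ∈ fockSpace n ∧ MemLp (fun w => g w * f w) 2 (fockMeasure n)}

/-- The densely defined operator `T_g` is bounded on the Fock space: on its domain it takes
values in the Fock space and satisfies `‖T_g f‖ ≤ C ‖f‖` in the norm of `L²(ℂⁿ, dμ)`. -/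
def ToeplitzBounded {n : ℕ} (g : (Fin n → ℂ) → ℂ) : Prop :=
  ∃ C : ℝ≥0, ∀ f ∈ toeplitzDomain g,
    toeplitz g f ∈ fockSpace n ∧
      eLpNorm (toeplitz g f) 2 (fockMeasure n) ≤ C * eLpNorm f 2 (fockMeasure n)

/-- The heat kernel `q_t(z) = (4πt)⁻ⁿ exp(-|z|²/(4t))` on `ℂⁿ`, as a complex-valued function. -/
def heatKernel (n : ℕ) (t : ℝ) (z : Fin n → ℂ) : ℂ :=
  ((((4 * Real.pi * t) ^ n)⁻¹ * Real.exp (-(absSq z) / (4 * t)) : ℝ) : ℂ)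

/-- The convolution `g * q_t`. -/
def heatFlow {n : ℕ} (t : ℝ) (g : (Fin n → ℂ) → ℂ) : (Fin n → ℂ) → ℂ :=
  MeasureTheory.convolution g (heatKernel n t) (ContinuousLinearMap.mul ℂ ℂ) volume

/-- The Laguerre polynomial `L_k^a(x) = ∑_{j ≤ k} (-1)^j C(k+a, k-j) x^j / j!`
(of integer type `a ≥ 0`). -/
def laguerre (k a : ℕ) (x : ℝ) : ℝ :=
  ∑ j ∈ Finset.range (k + 1), (-1) ^ j * ((k + a).choose (k - j) : ℝ) * x ^ j / (j ! : ℝ)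

/-- The Laguerre function `φ_k(z) = L_k^{n-1}(|z|²/2) exp(-|z|²/4)` of type `n - 1`, for `n ≥ 1`. -/
def laguerreFn (n k : ℕ) (z : Fin n → ℂ) : ℂ :=
  ((laguerre k (n - 1) (absSq z / 2) * Real.exp (-(absSq z) / 4) : ℝ) : ℂ)

/-- The sequence `k!(n-1)!/(k+n-1)! ∫ (g * q_{1/4})(w) φ_k(2w) dw`, for `n ≥ 1`. -/
def laguerreCoeff {n : ℕ} (g : (Fin n → ℂ) → ℂ) (k : ℕ) : ℂ :=
  ((k ! : ℂ) * ((n - 1)! : ℂ) / ((k + n - 1)! : ℂ)) *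
    ∫ w, heatFlow (1 / 4) g w * laguerreFn n k ((2 : ℂ) • w)

end

/-! A radial symbol acts on the monomials `ζ_α` diagonally, and its eigenvalue depends only on `k =
|α|`: it is the moment `∫ g |z|^{2k} dμ` divided by `∫ |z|^{2k} dμ`. The reason is that the
component of weight `k` of an entire function under the circle action is homogeneous of degree `k`
(Cauchy). Its product with `conj ζ_α` is therefore homogeneous of degree `2k`, and polar coordinates
split the integral of `g` times this product into a radial and a spherical factor
(`integral_radial_mul_homogeneous`, `integral_radial_mul_entire`).

Hence `T_g` is bounded iff its eigenvalues are (`toeplitzBounded_iff`). Necessity is tested on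
monomials. For sufficiency, expanding the reproducing kernel makes `T_g f` a pointwise limit of
finite monomial sums, and Fatou with Bessel's inequality bounds its norm; completeness of the
monomials is not needed.

It remains to see that the Laguerre coefficients are `(-1)^k π^n` times the eigenvalues
(`laguerreCoeff_eq`). Completing the square turns the heat kernel times `φ_k` into two Gaussian
weights times `L_k^{n-1}(|z+v|²/2)`. The Gaussian average of the latter over `v` is `(-1)^k
(|z|²/2)^k / k!` (`integral_laguerre_absSq`), so Fubini leaves the moment `∫ g |z|^{2k} dμ`. -/

/-! ### The Gaussian measure -/

/-- The density of the Gaussian measure on `ℂ` with variance `2`. -/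
noncomputable def planeDensity (z : ℂ) : ℝ := (2 * Real.pi)⁻¹ * Real.exp (-‖z‖ ^ 2 / 2)

/-- The Gaussian measure `(2π)⁻¹ exp(-|z|²/2) dz` on `ℂ`. -/
noncomputable def planeGaussian : Measure ℂ :=
  volume.withDensity fun z => ENNReal.ofReal (planeDensity z)

/-- The density of `fockMeasure n`. -/
noncomputable def fockDensity {n : ℕ} (z : Fin n → ℂ) : ℝ :=
  ((2 * Real.pi) ^ n)⁻¹ * Real.exp (-(absSq z) / 2)

theorem planeDensity_pos (z : ℂ) : 0 < planeDensity z := by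
  unfold planeDensity; positivity

theorem fockDensity_pos {n : ℕ} (z : Fin n → ℂ) : 0 < fockDensity z := by
  unfold fockDensity; positivity

theorem continuous_absSq {n : ℕ} : Continuous (absSq : (Fin n → ℂ) → ℝ) := by
  unfold absSq; fun_prop

theorem absSq_nonneg {n : ℕ} (z : Fin n → ℂ) : 0 ≤ absSq z := by
  unfold absSq; positivity

theorem continuous_planeDensity : Continuous planeDensity := by
  unfold planeDensity; fun_prop

theorem continuous_fockDensity {n : ℕ} : Continuous (fockDensity : (Fin n → ℂ) → ℝ) := by
  have := continuous_absSq (n := n)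
  unfold fockDensity; fun_prop

theorem fockDensity_eq_prod {n : ℕ} (z : Fin n → ℂ) :
    fockDensity z = ∏ i, planeDensity (z i) := by
  simp only [fockDensity, planeDensity, Finset.prod_mul_distrib, Finset.prod_const,
    Finset.card_univ, Fintype.card_fin, ← Real.exp_sum, inv_pow, absSq]
  rw [← Finset.sum_div, Finset.sum_neg_distrib]

section Density

variable {X : Type*} [MeasurableSpace X] {ν : Measure X} {ρ : X → ℝ}
  {F : Type*} [NormedAddCommGroup F] [NormedSpace ℝ F]

theorem integral_withDensity_ofReal (hρ : Measurable ρ) (h0 : ∀ x, 0 ≤ ρ x) (f : X → F) :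
    ∫ x, f x ∂(ν.withDensity fun x => ENNReal.ofReal (ρ x)) = ∫ x, ρ x • f x ∂ν := by
  rw [integral_withDensity_eq_integral_toReal_smul hρ.ennreal_ofReal (by simp)]
  simp [ENNReal.toReal_ofReal, h0]

theorem integrable_withDensity_ofReal_iff (hρ : Measurable ρ) (h0 : ∀ x, 0 ≤ ρ x) {f : X → F} :
    Integrable f (ν.withDensity fun x => ENNReal.ofReal (ρ x)) ↔
      Integrable (fun x => ρ x • f x) ν := by
  rw [integrable_withDensity_iff_integrable_smul' hρ.ennreal_ofReal (by simp)]
  simp [ENNReal.toReal_ofReal, h0]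

end Density

section Basic

variable {F : Type*} [NormedAddCommGroup F] [NormedSpace ℝ F] {n : ℕ}

theorem integral_fockMeasure (f : (Fin n → ℂ) → F) :
    ∫ z, f z ∂(fockMeasure n) = ∫ z, fockDensity z • f z :=
  integral_withDensity_ofReal continuous_fockDensity.measurable (fun z => (fockDensity_pos z).le) f

theorem integrable_fockMeasure_iff {f : (Fin n → ℂ) → F} :
    Integrable f (fockMeasure n) ↔ Integrable (fun z => fockDensity z • f z) :=
  integrable_withDensity_ofReal_iff continuous_fockDensity.measurable
    (fun z => (fockDensity_pos z).le)

theorem integral_planeGaussian (f : ℂ → F) :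
    ∫ z, f z ∂planeGaussian = ∫ z, planeDensity z • f z :=
  integral_withDensity_ofReal continuous_planeDensity.measurable (fun z => (planeDensity_pos z).le) f

theorem integrable_planeGaussian_iff {f : ℂ → F} :
    Integrable f planeGaussian ↔ Integrable (fun z => planeDensity z • f z) :=
  integrable_withDensity_ofReal_iff continuous_planeDensity.measurable
    (fun z => (planeDensity_pos z).le)

end Basic

theorem integral_fockMeasure_prod {n : ℕ} {𝕜 : Type*} [RCLike 𝕜] (f : Fin n → ℂ → 𝕜) :
    ∫ z, ∏ i, f i (z i) ∂(fockMeasure n) = ∏ i, ∫ z, f i z ∂planeGaussian := by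
  simp_rw [integral_fockMeasure, integral_planeGaussian, fockDensity_eq_prod]
  rw [← integral_fintype_prod_volume_eq_prod]
  congr 1 with z
  simp [RCLike.real_smul_eq_coe_mul, Finset.prod_mul_distrib]

theorem integrable_fockMeasure_prod {n : ℕ} {𝕜 : Type*} [RCLike 𝕜] {f : Fin n → ℂ → 𝕜}
    (hf : ∀ i, Integrable (f i) planeGaussian) :
    Integrable (fun z : Fin n → ℂ => ∏ i, f i (z i)) (fockMeasure n) := by
  rw [integrable_fockMeasure_iff]
  have := Integrable.fintype_prod (μ := fun _ : Fin n => (volume : Measure ℂ))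
    (fun i => integrable_planeGaussian_iff.1 (hf i))
  refine this.congr (.of_forall fun z => ?_)
  simp [RCLike.real_smul_eq_coe_mul, Finset.prod_mul_distrib, fockDensity_eq_prod]

theorem integrable_exp_neg_mul_norm_sq {b : ℝ} (hb : 0 < b) :
    Integrable (fun z : ℂ => Real.exp (-b * ‖z‖ ^ 2)) := by
  have h := Complex.integral_exp_neg_mul_rpow (p := 2) one_le_two hb
  simp only [Real.rpow_two] at h
  -- Without integrability the integral would take the default value `0`, but the closed form is
  -- positive.
  by_contra hc
  rw [integral_undef hc] at h
  have h2 : 0 < Real.pi * b ^ (-2 / 2 : ℝ) * Real.Gamma (2 / 2 + 1) := by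
    have := Real.rpow_pos_of_pos hb (-2 / 2)
    have := Real.Gamma_pos_of_pos (s := 2 / 2 + 1) (by norm_num)
    positivity
  exact h2.ne h

theorem integrable_exp_norm_planeGaussian (C : ℝ) :
    Integrable (fun z : ℂ => Real.exp (C * ‖z‖)) planeGaussian := by
  rw [integrable_planeGaussian_iff]
  refine Integrable.mono' ((integrable_exp_neg_mul_norm_sq (b := 1 / 4) (by norm_num)).const_mul
    ((2 * Real.pi)⁻¹ * Real.exp (C ^ 2))) ?_ (.of_forall fun z => ?_)
  · exact (continuous_planeDensity.smul (by fun_prop)).aestronglyMeasurable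
  · rw [Real.norm_of_nonneg (smul_nonneg (planeDensity_pos z).le (Real.exp_pos _).le)]
    simp only [planeDensity, smul_eq_mul, mul_assoc, ← Real.exp_add]
    refine mul_le_mul_of_nonneg_left (Real.exp_le_exp.2 ?_) (by positivity)
    -- With `r = ‖z‖`, the square gives `C r - r²/2 ≤ C² - r²/4`.
    nlinarith [sq_nonneg (C - ‖z‖ / 2)]

theorem integrable_exp_sum_norm {n : ℕ} (C : ℝ) :
    Integrable (fun z : Fin n → ℂ => Real.exp (C * ∑ i, ‖z i‖)) (fockMeasure n) := by
  simp only [Finset.mul_sum, Real.exp_sum]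
  exact integrable_fockMeasure_prod (f := fun _ z => Real.exp (C * ‖z‖))
    fun _ => integrable_exp_norm_planeGaussian C

instance {n : ℕ} : IsFiniteMeasure (fockMeasure n) := by
  -- With exponent `0` the integrable function is the constant `1`.
  have h := integrable_exp_sum_norm (n := n) 0
  simpa [integrable_const_iff, isFiniteMeasure_iff] using h

/-- A continuous function of at most exponential growth is square integrable. -/
theorem memLp_fockMeasure_of_norm_le {n : ℕ} {E : Type*} [NormedAddCommGroup E]
    {f : (Fin n → ℂ) → E}
    (hf : AEStronglyMeasurable f (fockMeasure n)) (A C : ℝ)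
    (hle : ∀ z, ‖f z‖ ≤ A * Real.exp (C * ∑ i, ‖z i‖)) : MemLp f 2 (fockMeasure n) := by
  refine (memLp_two_iff_integrable_sq_norm hf).2 ?_
  refine Integrable.mono' ((integrable_exp_sum_norm (n := n) (2 * C)).const_mul (A ^ 2))
    (hf.norm.pow 2) (.of_forall fun z => ?_)
  rw [Real.norm_of_nonneg (by positivity)]
  calc ‖f z‖ ^ 2 ≤ (A * Real.exp (C * ∑ i, ‖z i‖)) ^ 2 := by gcongr; exact hle z
    _ = A ^ 2 * Real.exp (2 * C * ∑ i, ‖z i‖) := by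
      rw [mul_pow, ← Real.exp_nat_mul]; push_cast; ring_nf

theorem norm_pow_le_exp (m : ℕ) (z : ℂ) : ‖z‖ ^ m ≤ m ! * Real.exp ‖z‖ := by
  rw [← div_le_iff₀' (by positivity)]
  exact Real.pow_div_factorial_le_exp _ (norm_nonneg _) _

theorem norm_prod_pow_le {n : ℕ} (α : Fin n → ℕ) (z : Fin n → ℂ) :
    ‖∏ i, z i ^ α i‖ ≤ (∏ i, (α i)! : ℕ) * Real.exp (1 * ∑ i, ‖z i‖) := by
  rw [one_mul, Real.exp_sum, norm_prod, Nat.cast_prod, ← Finset.prod_mul_distrib]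
  refine Finset.prod_le_prod (fun _ _ => norm_nonneg _) fun i _ => ?_
  rw [norm_pow]
  exact norm_pow_le_exp _ _

theorem absSq_le_exp {n : ℕ} (z : Fin n → ℂ) :
    1 + absSq z ≤ 2 * Real.exp (∑ i, ‖z i‖) := by
  have h1 : absSq z ≤ (∑ i, ‖z i‖) ^ 2 := by
    unfold absSq
    exact Finset.sum_sq_le_sq_sum_of_nonneg fun i _ => norm_nonneg _
  have hs : 0 ≤ ∑ i, ‖z i‖ := by positivity
  have := Real.quadratic_le_exp_of_nonneg hs
  nlinarith

theorem memLp_one_add_absSq_pow {n : ℕ} (k : ℕ) :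
    MemLp (fun z : Fin n → ℂ => (1 + absSq z) ^ k) 2 (fockMeasure n) := by
  have := continuous_absSq (n := n)
  refine memLp_fockMeasure_of_norm_le (by fun_prop) (2 ^ k) k fun z => ?_
  have h0 := absSq_nonneg z
  rw [Real.norm_of_nonneg (by positivity), mul_comm (k : ℝ), mul_comm _ (k : ℝ), Real.exp_nat_mul,
    ← mul_pow]
  gcongr
  exact absSq_le_exp z

theorem continuous_fockMonomial {n : ℕ} (α : Fin n → ℕ) : Continuous (fockMonomial α) := by
  unfold fockMonomial; fun_prop

theorem differentiable_fockMonomial {n : ℕ} (α : Fin n → ℕ) :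
    Differentiable ℂ (fockMonomial α) := by
  unfold fockMonomial; fun_prop

theorem memLp_fockMonomial {n : ℕ} (α : Fin n → ℕ) :
    MemLp (fockMonomial α) 2 (fockMeasure n) := by
  have h : MemLp (fun z : Fin n → ℂ => ∏ i, z i ^ α i) 2 (fockMeasure n) :=
    memLp_fockMeasure_of_norm_le
      (by fun_prop : Continuous fun z : Fin n → ℂ => ∏ i, z i ^ α i).aestronglyMeasurable
      _ 1 (norm_prod_pow_le α)
  have h2 := h.const_mul ((√(2 ^ (∑ i, α i)) * √((∏ i, (α i)! : ℕ) : ℝ) : ℝ) : ℂ)⁻¹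
  convert! h2 using 1
  ext z
  simp only [fockMonomial, div_eq_inv_mul]

theorem fockMonomial_mem_fockSpace {n : ℕ} (α : Fin n → ℕ) : fockMonomial α ∈ fockSpace n :=
  ⟨differentiable_fockMonomial α, memLp_fockMonomial α⟩

/-! ### Moments -/

theorem integral_comp_unit_mul (F : ℂ → ℂ) {u : ℂ} (hu : ‖u‖ = 1) :
    ∫ z, F (u * z) ∂planeGaussian = ∫ z, F z ∂planeGaussian := by
  rw [integral_planeGaussian, integral_planeGaussian]
  let e : ℂ ≃ₗᵢ[ℝ] ℂ := rotation ⟨u, by simp [Submonoid.unitSphere, hu]⟩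
  have := (e.measurePreserving).integral_comp e.toHomeomorph.measurableEmbedding
    (fun z => planeDensity z • F z)
  rw [← this]
  congr 1 with z
  have : e z = u * z := rfl
  simp [this, planeDensity, hu]

/-- Rotating by a unit `u` multiplies the integral by `u^a ū^b`, so one `u` with `u^(a-b) ≠ 1` is
enough. -/
theorem integral_pow_mul_conj_pow_of_ne {a b : ℕ} (hab : a ≠ b) :
    ∫ z : ℂ, z ^ a * conj z ^ b ∂planeGaussian = 0 := by
  obtain ⟨u, hu, hne⟩ : ∃ u : ℂ, ‖u‖ = 1 ∧ u ^ a * conj u ^ b ≠ 1 := by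
    -- The angle of one radian works for all `a ≠ b` at once, because `π` is irrational.
    refine ⟨Complex.exp ((1 : ℝ) * Complex.I), Complex.norm_exp_ofReal_mul_I 1, fun h => hab ?_⟩
    rw [← Complex.exp_conj, ← Complex.exp_nat_mul, ← Complex.exp_nat_mul, ← Complex.exp_add,
      Complex.exp_eq_one_iff] at h
    obtain ⟨m, hm⟩ := h
    have h3 := congrArg Complex.im hm
    simp at h3
    by_cases hm0 : m = 0
    · subst hm0
      simp at h3
      exact_mod_cast (by linarith : (a : ℝ) = b)
    · exfalso
      have hirr := irrational_pi
      refine hirr ⟨((a : ℚ) - b) / (2 * m), ?_⟩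
      have : (m : ℝ) ≠ 0 := by exact_mod_cast hm0
      push_cast
      field_simp
      linarith
  have h := integral_comp_unit_mul (fun z => z ^ a * conj z ^ b) hu
  have h2 : ∀ z : ℂ, (u * z) ^ a * conj (u * z) ^ b = (u ^ a * conj u ^ b) * (z ^ a * conj z ^ b) := by
    intro z; rw [map_mul]; ring
  simp only [h2] at h
  rw [integral_const_mul] at h
  have : (u ^ a * conj u ^ b - 1) * ∫ z : ℂ, z ^ a * conj z ^ b ∂planeGaussian = 0 := by
    rw [sub_mul, h, one_mul, sub_self]
  exact (mul_eq_zero.1 this).resolve_left (sub_ne_zero.2 hne)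

theorem integral_norm_pow_planeGaussian (a : ℕ) :
    ∫ z : ℂ, ‖z‖ ^ (2 * a) ∂planeGaussian = 2 ^ a * a ! := by
  rw [integral_planeGaussian]
  have h := Complex.integral_rpow_mul_exp_neg_mul_rpow (p := 2) (q := 2 * a) (b := 1 / 2) one_le_two
    (by have : (0 : ℝ) ≤ a := by positivity
        linarith) (by norm_num)
  have h1 : ((2 * a + 2 : ℝ) / 2) = a + 1 := by ring
  have h2 : (-(2 * a + 2 : ℝ) / 2) = -((a + 1 : ℕ) : ℝ) := by push_cast; ring
  rw [h1, h2, Real.Gamma_nat_eq_factorial, Real.rpow_neg (by norm_num), Real.rpow_natCast] at h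
  have h3 : ∀ z : ℂ, planeDensity z • ‖z‖ ^ (2 * a) =
      (2 * Real.pi)⁻¹ * (‖z‖ ^ (2 * a : ℝ) * Real.exp (-(1 / 2) * ‖z‖ ^ (2 : ℝ))) := by
    intro z
    rw [Real.rpow_two, show (2 * a : ℝ) = ((2 * a : ℕ) : ℝ) by push_cast; rfl, Real.rpow_natCast,
      planeDensity, smul_eq_mul]
    ring_nf
  simp_rw [h3]
  rw [integral_const_mul, h]
  have := Real.pi_ne_zero
  field_simp
  simp only [one_div, inv_pow, pow_succ]
  field_simp

theorem integral_pow_mul_conj_pow (a b : ℕ) :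
    ∫ z : ℂ, z ^ a * conj z ^ b ∂planeGaussian = if a = b then (2 : ℂ) ^ a * a ! else 0 := by
  split_ifs with hab
  · subst hab
    have : ∀ z : ℂ, z ^ a * conj z ^ a = ((‖z‖ ^ (2 * a) : ℝ) : ℂ) := by
      intro z; rw [← mul_pow, Complex.mul_conj']; push_cast; ring
    simp_rw [this]
    rw [integral_complex_ofReal, integral_norm_pow_planeGaussian]
    push_cast; rfl
  · exact integral_pow_mul_conj_pow_of_ne hab

theorem integrable_planeGaussian_of_norm_le {f : ℂ → ℂ} (hf : Continuous f) (A C : ℝ)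
    (hle : ∀ z, ‖f z‖ ≤ A * Real.exp (C * ‖z‖)) : Integrable f planeGaussian :=
  Integrable.mono' ((integrable_exp_norm_planeGaussian C).const_mul A) hf.aestronglyMeasurable
    (.of_forall hle)

theorem integrable_pow_mul_conj_pow (a b : ℕ) :
    Integrable (fun z : ℂ => z ^ a * conj z ^ b) planeGaussian := by
  refine integrable_planeGaussian_of_norm_le (by fun_prop) (a ! * b !) 2 fun z => ?_
  calc ‖z ^ a * conj z ^ b‖ = ‖z‖ ^ a * ‖z‖ ^ b := by simp
    _ ≤ (a ! * Real.exp ‖z‖) * (b ! * Real.exp ‖z‖) := by gcongr <;> apply norm_pow_le_exp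
    _ = a ! * b ! * Real.exp (2 * ‖z‖) := by rw [two_mul ‖z‖, Real.exp_add]; ring

theorem integral_fockMonomial_mul_conj {n : ℕ} (α β : Fin n → ℕ) :
    ∫ z, fockMonomial α z * conj (fockMonomial β z) ∂(fockMeasure n) =
      if α = β then 1 else 0 := by
  have h : ∀ z : Fin n → ℂ, fockMonomial α z * conj (fockMonomial β z) =
      ((√(2 ^ (∑ i, α i)) * √((∏ i, (α i)! : ℕ) : ℝ) : ℝ) : ℂ)⁻¹ *
      ((√(2 ^ (∑ i, β i)) * √((∏ i, (β i)! : ℕ) : ℝ) : ℝ) : ℂ)⁻¹ *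
        ∏ i, (z i ^ α i * conj (z i) ^ β i) := by
    intro z
    simp only [fockMonomial, map_div₀, map_prod, map_pow, Complex.conj_ofReal,
      Finset.prod_mul_distrib]
    ring
  simp_rw [h]
  rw [integral_const_mul, integral_fockMeasure_prod (f := fun i z => z ^ α i * conj z ^ β i)]
  simp_rw [integral_pow_mul_conj_pow]
  split_ifs with hab
  · subst hab
    simp only [if_true]
    rw [Finset.prod_mul_distrib, Finset.prod_pow_eq_pow_sum, ← mul_inv, ← Complex.ofReal_mul]
    have h1 : ∀ x y : ℝ, 0 ≤ x → 0 ≤ y → √x * √y * (√x * √y) = x * y := fun x y hx hy => by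
      rw [mul_mul_mul_comm, Real.mul_self_sqrt hx, Real.mul_self_sqrt hy]
    rw [h1 _ _ (by positivity) (by positivity)]
    push_cast
    rw [inv_mul_cancel₀]
    refine mul_ne_zero (pow_ne_zero _ two_ne_zero) (Finset.prod_ne_zero_iff.2 fun i _ => ?_)
    exact_mod_cast (α i).factorial_ne_zero
  · obtain ⟨i, hi⟩ := Function.ne_iff.1 hab
    exact mul_eq_zero_of_right _ (Finset.prod_eq_zero (Finset.mem_univ i) (if_neg hi))

/-! ### Radial functions against homogeneous functions -/

theorem absSq_smul {n : ℕ} (c : ℂ) (z : Fin n → ℂ) : absSq (c • z) = ‖c‖ ^ 2 * absSq z := by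
  simp [absSq, mul_pow, Finset.mul_sum]

theorem absSq_real_smul {n : ℕ} (r : ℝ) (z : Fin n → ℂ) : absSq (r • z) = r ^ 2 * absSq z := by
  simp [absSq, mul_pow, Finset.mul_sum]

theorem absSq_single {n : ℕ} (i : Fin n) (c : ℂ) : absSq (Pi.single i c) = ‖c‖ ^ 2 := by
  unfold absSq
  rw [Finset.sum_eq_single i] <;> simp +contextual

/-- Polar coordinates: the integral of a radial function times a homogeneous function splits into
a radial integral and a spherical integral. -/
theorem exists_integral_radial_mul_homogeneous {n : ℕ} (hn : 1 ≤ n) (m : ℕ) :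
    ∃ (A B : ((Fin n → ℂ) → ℂ) → ℂ), ∀ q H : (Fin n → ℂ) → ℂ, IsRadial q →
      (∀ r : ℝ, 0 < r → ∀ z, H (r • z) = (r : ℂ) ^ m * H z) →
      ∫ z, q z * H z = A q * B H := by
  let E := EuclideanSpace ℂ (Fin n)
  let L : (Fin n → ℂ) ≃L[ℝ] E := (PiLp.continuousLinearEquiv 2 ℝ (fun _ : Fin n => ℂ)).symm
  let ν : Measure E := Measure.map L volume
  have : ν.IsAddHaarMeasure := L.isAddHaarMeasure_map volume
  have : Nonempty (Fin n) := ⟨⟨0, hn⟩⟩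
  let i0 : Fin n := ⟨0, hn⟩
  let d := Module.finrank ℝ E - 1
  -- A radial `q` is read off along one coordinate axis; `B` integrates over the unit sphere.
  refine ⟨fun q => ∫ r : Set.Ioi (0 : ℝ), q (Pi.single i0 ((r : ℝ) : ℂ)) * ((r : ℝ) : ℂ) ^ m
    ∂(Measure.volumeIoiPow d), fun H => ∫ s, H (L.symm s.1) ∂ν.toSphere, fun q H hq hH => ?_⟩
  have key : ∀ F : E → ℂ, ∫ x, F x ∂ν = ∫ p : Metric.sphere (0 : E) 1 × Set.Ioi (0 : ℝ),
      F ((p.2 : ℝ) • (p.1 : E)) ∂(ν.toSphere.prod (Measure.volumeIoiPow d)) := by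
    intro F
    calc ∫ x, F x ∂ν = ∫ x : ({(0)}ᶜ : Set E), F x.1 ∂(ν.comap (↑)) := by
          rw [integral_subtype_comap (measurableSet_singleton _).compl F,
            restrict_compl_singleton]
      _ = _ := by
        rw [← ν.measurePreserving_homeomorphUnitSphereProd.integral_comp
          (Homeomorph.measurableEmbedding _)]
        refine integral_congr_ae (.of_forall fun x => ?_)
        have hx : ‖(x : E)‖ ≠ 0 := norm_ne_zero_iff.2 x.2
        simp [smul_smul, hx]
  calc ∫ z, q z * H z = ∫ x, q (L.symm x) * H (L.symm x) ∂ν := by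
        have hL : MeasurableEmbedding L := L.toHomeomorph.measurableEmbedding
        rw [hL.integral_map]
        simp
    _ = ∫ p : Metric.sphere (0 : E) 1 × Set.Ioi (0 : ℝ),
        H (L.symm p.1.1) * (q (Pi.single i0 ((p.2 : ℝ) : ℂ)) * ((p.2 : ℝ) : ℂ) ^ m)
        ∂(ν.toSphere.prod (Measure.volumeIoiPow d)) := by
        rw [key]
        refine integral_congr_ae (.of_forall fun p => ?_)
        have hs : absSq (L.symm p.1.1) = 1 := by
          have h1 : ‖(p.1.1 : E)‖ = 1 := by simp
          have h2 := EuclideanSpace.norm_sq_eq (𝕜 := ℂ) p.1.1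
          rw [h1, one_pow] at h2
          exact h2.symm
        have h3 : L.symm ((p.2 : ℝ) • (p.1.1 : E)) = (p.2 : ℝ) • L.symm p.1.1 := map_smul _ _ _
        simp only [h3]
        rw [hH _ p.2.2, hq ((p.2 : ℝ) • L.symm p.1.1) (Pi.single i0 ((p.2 : ℝ) : ℂ))]
        · ring
        · rw [absSq_real_smul, hs, absSq_single]; simp
    _ = _ := by
        -- This factorization needs no integrability, so `A` and `B` serve all `q` and `H`.
        rw [integral_prod_mul (fun s : Metric.sphere (0 : E) 1 => H (L.symm s.1))
          (fun r : Set.Ioi (0 : ℝ) => q (Pi.single i0 ((r : ℝ) : ℂ)) * ((r : ℝ) : ℂ) ^ m), mul_comm]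

/-- Against a homogeneous function of degree `2k`, a radial function acts under the Gaussian
measure as multiplication by a constant. -/
theorem integral_radial_mul_homogeneous {n : ℕ} (hn : 1 ≤ n) (k : ℕ) {g H : (Fin n → ℂ) → ℂ}
    (hg : IsRadial g) (hH : ∀ r : ℝ, 0 < r → ∀ z, H (r • z) = (r : ℂ) ^ (2 * k) * H z) :
    (∫ z, g z * H z ∂(fockMeasure n)) * ((∫ z, absSq z ^ k ∂(fockMeasure n) : ℝ) : ℂ) =
      (∫ z, H z ∂(fockMeasure n)) * ∫ z, g z * (absSq z : ℂ) ^ k ∂(fockMeasure n) := by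
  obtain ⟨A, B, hAB⟩ := exists_integral_radial_mul_homogeneous hn (2 * k)
  have hρ : IsRadial fun z : Fin n → ℂ => (fockDensity z : ℂ) := fun z w h => by
    simp [fockDensity, h]
  have hgρ : IsRadial fun z : Fin n → ℂ => (fockDensity z : ℂ) * g z := fun z w h => by
    simp only [hg z w h, hρ z w h]
  have hH0 : ∀ r : ℝ, 0 < r → ∀ z : Fin n → ℂ,
      ((absSq (r • z) : ℝ) : ℂ) ^ k = (r : ℂ) ^ (2 * k) * (absSq z : ℂ) ^ k := fun r _ z => by
    rw [absSq_real_smul]; push_cast; ring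
  rw [← integral_complex_ofReal]
  simp only [integral_fockMeasure, Complex.real_smul, Complex.ofReal_pow, ← mul_assoc]
  -- Both sides become the same product `A(ρg) B(H) A(ρ) B(|z|^{2k})`, where `ρ` is the density.
  rw [hAB _ H hgρ hH, hAB _ _ hgρ hH0, hAB _ H hρ hH, hAB _ _ hρ hH0]
  ring

/-! ### Rotations -/

theorem measurePreserving_unit_smul {n : ℕ} {u : ℂ} (hu : ‖u‖ = 1) :
    MeasurePreserving (fun z : Fin n → ℂ => u • z) (fockMeasure n) (fockMeasure n) := by
  have hv : MeasurePreserving (fun z : Fin n → ℂ => u • z) volume volume :=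
    volume_preserving_pi (fun _ =>
      (rotation ⟨u, by simp [Submonoid.unitSphere, hu]⟩ : ℂ ≃ₗᵢ[ℝ] ℂ).measurePreserving)
  refine ⟨hv.measurable, Measure.ext fun s hs => ?_⟩
  rw [Measure.map_apply hv.measurable hs, fockMeasure, withDensity_apply _ (hv.measurable hs),
    withDensity_apply _ hs, ← hv.setLIntegral_comp_preimage hs]
  · simp [absSq_smul, hu]
  · have := continuous_absSq (n := n)
    fun_prop

/-- Averaging an integrable function over the circle action does not change its integral. -/
theorem integral_circle_average {n : ℕ} {G : (Fin n → ℂ) → ℂ}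
    (hG : Integrable G (fockMeasure n)) :
    ∫ z, (∫ θ in (0 : ℝ)..2 * Real.pi, G (Complex.exp (θ * Complex.I) • z)) ∂(fockMeasure n) =
      2 * Real.pi * ∫ z, G z ∂(fockMeasure n) := by
  let τ : Measure ℝ := volume.restrict (Set.Ioc 0 (2 * Real.pi))
  -- The shear `(θ, z) ↦ (θ, e^{iθ} z)` supplies the joint integrability that Fubini requires.
  have hT : MeasurePreserving
      (fun p : ℝ × (Fin n → ℂ) => (p.1, Complex.exp (p.1 * Complex.I) • p.2))
      (τ.prod (fockMeasure n)) (τ.prod (fockMeasure n)) := by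
    refine (MeasurePreserving.id τ).skew_product
      (g := fun (θ : ℝ) (z : Fin n → ℂ) => Complex.exp (θ * Complex.I) • z) ?_ ?_
    · exact Continuous.measurable (by fun_prop)
    · exact .of_forall fun θ => (measurePreserving_unit_smul (Complex.norm_exp_ofReal_mul_I θ)).map_eq
  have hG2 : Integrable (fun p : ℝ × (Fin n → ℂ) => G p.2) (τ.prod (fockMeasure n)) :=
    hG.comp_snd τ
  have hG3 := hT.integrable_comp_of_integrable hG2
  simp_rw [intervalIntegral.integral_of_le Real.two_pi_pos.le]
  rw [← integral_integral_swap (μ := τ) (f := fun (θ : ℝ) (z : Fin n → ℂ) =>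
    G (Complex.exp (θ * Complex.I) • z)) hG3]
  have : ∀ θ : ℝ, ∫ z, G (Complex.exp (θ * Complex.I) • z) ∂(fockMeasure n) =
      ∫ z, G z ∂(fockMeasure n) := fun θ => by
    have hm := measurePreserving_unit_smul (n := n) (Complex.norm_exp_ofReal_mul_I θ)
    conv_rhs => rw [← hm.map_eq]
    rw [integral_map hm.aemeasurable (by rw [hm.map_eq]; exact hG.1)]
  simp_rw [this]
  simp [τ, Real.two_pi_pos.le]

/-- `2π` times the component of weight `k` of `f` under the circle action. -/
noncomputable def circleComponent {n : ℕ} (k : ℕ) (f : (Fin n → ℂ) → ℂ) (z : Fin n → ℂ) : ℂ :=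
  ∫ θ in (0 : ℝ)..2 * Real.pi,
    f (Complex.exp (θ * Complex.I) • z) * Complex.exp (-(k * θ * Complex.I))

/-- Cauchy integrals of `h(t) / t^(k+1)` encode Fourier coefficients on circles; homogeneity of the
weight component then becomes independence of the radius. -/
theorem circleIntegral_inv_smul_div_pow (h : ℂ → ℂ) (k : ℕ) {R : ℝ} (hR : 0 < R) :
    (∮ t in C(0, R), (t - 0)⁻¹ • (h t / t ^ k)) = Complex.I * ((R : ℂ) ^ k)⁻¹ *
      ∫ θ in (0 : ℝ)..2 * Real.pi,
        h (R * Complex.exp (θ * Complex.I)) * Complex.exp (-(k * θ * Complex.I)) := by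
  rw [circleIntegral, ← intervalIntegral.integral_const_mul]
  refine intervalIntegral.integral_congr fun θ _ => ?_
  have hR' : (R : ℂ) ≠ 0 := by exact_mod_cast hR.ne'
  have he := Complex.exp_ne_zero (θ * Complex.I)
  have h2 : Complex.exp (-(k * θ * Complex.I)) = (Complex.exp (θ * Complex.I) ^ k)⁻¹ := by
    rw [← Complex.exp_nat_mul, ← Complex.exp_neg]; ring_nf
  simp only [deriv_circleMap, circleMap_zero, sub_zero, smul_eq_mul, h2, mul_pow]
  field_simp

/-- On the complex line through `z`, the Cauchy integral is the same over the circles of radius `r`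
and `1`, since the integrand is holomorphic on the annulus between them and the singularity at `0`
is avoided. -/
theorem circleComponent_smul {n : ℕ} (k : ℕ) {f : (Fin n → ℂ) → ℂ} (hf : Differentiable ℂ f)
    {r : ℝ} (hr : 0 < r) (z : Fin n → ℂ) :
    circleComponent k f (r • z) = (r : ℂ) ^ k * circleComponent k f z := by
  let h : ℂ → ℂ := fun t => f (t • z)
  have hh : Differentiable ℂ h := hf.comp (differentiable_id.smul_const z)
  have hd : ∀ t : ℂ, t ≠ 0 → DifferentiableAt ℂ (fun t => h t / t ^ k) t := fun t ht =>
    (hh t).div (by fun_prop) (pow_ne_zero _ ht)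
  have key : ∀ a b : ℝ, 0 < a → a ≤ b →
      (∮ t in C(0, b), (t - 0)⁻¹ • (h t / t ^ k)) = ∮ t in C(0, a), (t - 0)⁻¹ • (h t / t ^ k) := by
    intro a b ha hab
    refine Complex.circleIntegral_sub_center_inv_smul_eq_of_differentiable_on_annulus_off_countable
      ha hab Set.countable_empty (fun t ht => ((hd t ?_).continuousAt).continuousWithinAt)
      (fun t ht => hd t ?_)
    · rintro rfl; exact ht.2 (by simpa using ha)
    · rintro rfl; exact ht.1.2 (by simpa using ha.le)
  have key2 : (∮ t in C(0, r), (t - 0)⁻¹ • (h t / t ^ k)) =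
      ∮ t in C(0, 1), (t - 0)⁻¹ • (h t / t ^ k) := by
    rcases le_total 1 r with h1 | h1
    · exact key 1 r one_pos h1
    · exact (key r 1 hr h1).symm
  rw [circleIntegral_inv_smul_div_pow h k hr, circleIntegral_inv_smul_div_pow h k one_pos] at key2
  have hr' : (r : ℂ) ≠ 0 := by exact_mod_cast hr.ne'
  have h1 : circleComponent k f z = ∫ θ in (0 : ℝ)..2 * Real.pi,
        h ((1 : ℝ) * Complex.exp (θ * Complex.I)) * Complex.exp (-(k * θ * Complex.I)) := by
    simp [circleComponent, h]
  have h2 : circleComponent k f (r • z) = ∫ θ in (0 : ℝ)..2 * Real.pi,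
        h (r * Complex.exp (θ * Complex.I)) * Complex.exp (-(k * θ * Complex.I)) := by
    unfold circleComponent
    congr! 3 with θ
    simp only [h]
    congr 1
    ext i
    simp; ring
  rw [h1, h2]
  simp only [Complex.ofReal_one, one_pow, inv_one, mul_one] at key2 ⊢
  have hI := Complex.I_ne_zero
  rw [mul_assoc] at key2
  have := mul_left_cancel₀ hI key2
  rw [← this, mul_inv_cancel_left₀ (pow_ne_zero _ hr')]

theorem fockMonomial_smul {n : ℕ} (α : Fin n → ℕ) (c : ℂ) (z : Fin n → ℂ) :
    fockMonomial α (c • z) = c ^ (∑ i, α i) * fockMonomial α z := by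
  simp only [fockMonomial, Pi.smul_apply, smul_eq_mul, mul_pow, Finset.prod_mul_distrib,
    Finset.prod_pow_eq_pow_sum]
  ring

/-- The radial `g` is fixed by `z ↦ e^{iθ} z`, while `conj ζ_α` contributes `e^{-i|α|θ}`, exactly
the weight in the circle component. -/
theorem integral_radial_mul_circleComponent {n : ℕ} {g f : (Fin n → ℂ) → ℂ} (hg : IsRadial g)
    (α : Fin n → ℕ)
    (hint : Integrable (fun z => g z * f z * conj (fockMonomial α z)) (fockMeasure n)) :
    ∫ z, g z * (circleComponent (∑ i, α i) f z * conj (fockMonomial α z)) ∂(fockMeasure n) =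
      2 * Real.pi * ∫ z, g z * f z * conj (fockMonomial α z) ∂(fockMeasure n) := by
  rw [← integral_circle_average hint]
  congr 1 with z
  rw [circleComponent, ← intervalIntegral.integral_mul_const, ← intervalIntegral.integral_const_mul]
  congr 1 with θ
  rw [hg (Complex.exp (θ * Complex.I) • z) z (by rw [absSq_smul, Complex.norm_exp_ofReal_mul_I]; ring),
    fockMonomial_smul, map_mul, map_pow, ← Complex.exp_conj, ← Complex.exp_nat_mul]
  simp only [map_mul, Complex.conj_ofReal, Complex.conj_I]
  ring_nf

/-- On the Fock space, a radial symbol acts diagonally on the monomials. -/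
theorem integral_radial_mul_entire {n : ℕ} (hn : 1 ≤ n) {g f : (Fin n → ℂ) → ℂ} (hg : IsRadial g)
    (hf : Differentiable ℂ f) (α : Fin n → ℕ)
    (hint : Integrable (fun z => g z * f z * conj (fockMonomial α z)) (fockMeasure n))
    (hint' : Integrable (fun z => f z * conj (fockMonomial α z)) (fockMeasure n)) :
    (∫ z, g z * f z * conj (fockMonomial α z) ∂(fockMeasure n)) *
        ((∫ z, absSq z ^ (∑ i, α i) ∂(fockMeasure n) : ℝ) : ℂ) =
      (∫ z, f z * conj (fockMonomial α z) ∂(fockMeasure n)) *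
        ∫ z, g z * (absSq z : ℂ) ^ (∑ i, α i) ∂(fockMeasure n) := by
  have h1 := integral_radial_mul_circleComponent hg α hint
  -- The constant symbol `1` gives the companion identity for the coefficient of `f` itself.
  have h2 := integral_radial_mul_circleComponent (g := fun _ => 1) (fun _ _ _ => rfl) α
    (by simpa using hint')
  simp only [one_mul] at h2
  have h3 := integral_radial_mul_homogeneous hn (∑ i, α i)
    (H := fun z => circleComponent (∑ i, α i) f z * conj (fockMonomial α z)) hg fun r hr z => by
      rw [circleComponent_smul _ hf hr, show r • z = (r : ℂ) • z from rfl, fockMonomial_smul,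
        map_mul, map_pow, Complex.conj_ofReal]
      ring
  rw [h1, h2] at h3
  have hpi : (2 * Real.pi : ℂ) ≠ 0 := by exact_mod_cast Real.two_pi_pos.ne'
  refine mul_left_cancel₀ hpi ?_
  simpa only [mul_assoc] using h3

/-! ### Expansion of the reproducing kernel -/

theorem fockMonomial_mul_conj {n : ℕ} (α : Fin n → ℕ) (z w : Fin n → ℂ) :
    fockMonomial α z * conj (fockMonomial α w) =
      (∏ i, (z i * conj (w i)) ^ α i) / (2 ^ (∑ i, α i) * (∏ i, (α i)! : ℕ)) := by
  have h1 : ∀ x y : ℝ, 0 ≤ x → 0 ≤ y → √x * √y * (√x * √y) = x * y := fun x y hx hy => by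
    rw [mul_mul_mul_comm, Real.mul_self_sqrt hx, Real.mul_self_sqrt hy]
  simp only [fockMonomial, map_div₀, map_prod, map_pow, Complex.conj_ofReal, div_mul_div_comm,
    ← Complex.ofReal_mul, mul_pow, Finset.prod_mul_distrib]
  rw [h1 _ _ (by positivity) (by positivity)]
  push_cast
  rfl

/-- Multinomial theorem; the normalization of `ζ_α` makes the factor `2^k k!` common to all `α` of
weight `k`. -/
theorem hermProd_pow {n : ℕ} (k : ℕ) (z w : Fin n → ℂ) :
    hermProd z w ^ k = 2 ^ k * k ! *
      ∑ α ∈ Finset.piAntidiag Finset.univ k, fockMonomial α z * conj (fockMonomial α w) := by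
  rw [hermProd, Finset.sum_pow_eq_sum_piAntidiag, Finset.mul_sum]
  refine Finset.sum_congr rfl fun α hα => ?_
  have hk : ∑ i, α i = k := (Finset.mem_piAntidiag.1 hα).1
  have hm := Nat.multinomial_spec Finset.univ α
  rw [hk] at hm
  rw [fockMonomial_mul_conj, ← hm, hk]
  have : ((∏ i, (α i)! : ℕ) : ℂ) ≠ 0 := by
    exact_mod_cast Finset.prod_ne_zero_iff.2 fun i _ => (α i).factorial_ne_zero
  push_cast at this ⊢
  field_simp

theorem hermProd_self {n : ℕ} (z : Fin n → ℂ) : hermProd z z = absSq z := by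
  simp [hermProd, absSq, Complex.mul_conj']

theorem card_piAntidiag_univ (n k : ℕ) :
    (Finset.piAntidiag (Finset.univ : Finset (Fin n)) k).card = (n + k - 1).choose k := by
  have h := Finset.card_finsuppAntidiag_nat_eq_choose (s := (Finset.univ : Finset (Fin n))) k
  rw [Finset.card_univ, Fintype.card_fin] at h
  rw [← h]
  refine Finset.card_bij (fun f _ => Finsupp.equivFunOnFinite.symm f) ?_ ?_ ?_
  · intro f hf
    simpa using hf
  · intro f _ f' _ hff
    exact Finsupp.equivFunOnFinite.symm.injective hff
  · intro f hf
    refine ⟨f, ?_, by simp⟩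
    simpa using hf

theorem integrable_fockMonomial_mul_conj {n : ℕ} (α β : Fin n → ℕ) :
    Integrable (fun z => fockMonomial α z * conj (fockMonomial β z)) (fockMeasure n) :=
  (memLp_fockMonomial α).integrable_mul (memLp_fockMonomial β).star

/-- Since `|z|^{2k}` is the `k`-th power of `hermProd z z`, it equals `2^k k!` times the sum of the
`|ζ_α|²` with `|α| = k`. Each of these integrates to `1`, so the integral counts multi-indices. -/
theorem integral_absSq_pow (n k : ℕ) :
    ∫ z : Fin n → ℂ, absSq z ^ k ∂(fockMeasure n) = 2 ^ k * k ! * (n + k - 1).choose k := by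
  have h : ∫ z : Fin n → ℂ, ((absSq z ^ k : ℝ) : ℂ) ∂(fockMeasure n) =
      2 ^ k * k ! * (n + k - 1).choose k := by
    simp only [Complex.ofReal_pow, ← hermProd_self, hermProd_pow]
    rw [integral_const_mul, integral_finsetSum _ fun α _ => integrable_fockMonomial_mul_conj α α]
    simp [integral_fockMonomial_mul_conj, card_piAntidiag_univ]
  rw [integral_complex_ofReal] at h
  exact_mod_cast h

theorem norm_hermProd_le {n : ℕ} (z w : Fin n → ℂ) : ‖hermProd z w‖ ≤ ‖z‖ * ∑ i, ‖w i‖ := by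
  rw [Finset.mul_sum]
  refine (norm_sum_le _ _).trans (Finset.sum_le_sum fun i _ => ?_)
  rw [norm_mul, RCLike.norm_conj]
  gcongr
  exact norm_le_pi_norm z i

theorem continuous_hermProd {n : ℕ} (z : Fin n → ℂ) : Continuous (hermProd z) := by
  unfold hermProd; fun_prop

theorem memLp_exp_sum_norm {n : ℕ} (C : ℝ) :
    MemLp (fun z : Fin n → ℂ => Real.exp (C * ∑ i, ‖z i‖)) 2 (fockMeasure n) :=
  memLp_fockMeasure_of_norm_le
    (by fun_prop : Continuous fun z : Fin n → ℂ => Real.exp (C * ∑ i, ‖z i‖)).aestronglyMeasurable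
    1 C fun z => by
    rw [one_mul, Real.norm_of_nonneg (Real.exp_pos _).le]

/-! ### The projection onto the Fock space -/

/-- The coefficient of `u` along `ζ_α`. -/
noncomputable def fockCoeff {n : ℕ} (u : (Fin n → ℂ) → ℂ) (α : Fin n → ℕ) : ℂ :=
  ∫ w, u w * conj (fockMonomial α w) ∂(fockMeasure n)

theorem integrable_mul_conj_fockMonomial {n : ℕ} {u : (Fin n → ℂ) → ℂ}
    (hu : MemLp u 2 (fockMeasure n)) (α : Fin n → ℕ) :
    Integrable (fun w => u w * conj (fockMonomial α w)) (fockMeasure n) :=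
  hu.integrable_mul (memLp_fockMonomial α).star

/-- The multi-indices of weight less than `N`. -/
def multiIndexLT (n N : ℕ) : Finset (Fin n → ℕ) :=
  (Finset.range N).biUnion fun k => Finset.piAntidiag Finset.univ k

theorem mem_multiIndexLT {n N : ℕ} {α : Fin n → ℕ} :
    α ∈ multiIndexLT n N ↔ ∑ i, α i < N := by
  simp [multiIndexLT]

theorem sum_multiIndexLT {n N : ℕ} (F : (Fin n → ℕ) → ℂ) :
    ∑ α ∈ multiIndexLT n N, F α =
      ∑ k ∈ Finset.range N, ∑ α ∈ Finset.piAntidiag Finset.univ k, F α := by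
  refine Finset.sum_biUnion fun a _ b _ hab => ?_
  rw [Function.onFun, Finset.disjoint_left]
  intro α h1 h2
  exact hab ((Finset.mem_piAntidiag.1 h1).1.symm.trans (Finset.mem_piAntidiag.1 h2).1)

theorem sum_fockMonomial_mul_conj {n N : ℕ} (z w : Fin n → ℂ) :
    ∑ α ∈ multiIndexLT n N, fockMonomial α z * conj (fockMonomial α w) =
      ∑ k ∈ Finset.range N, (hermProd z w / 2) ^ k / k ! := by
  rw [sum_multiIndexLT]
  refine Finset.sum_congr rfl fun k _ => ?_
  rw [div_pow, hermProd_pow]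
  have : (k ! : ℂ) ≠ 0 := by exact_mod_cast k.factorial_ne_zero
  field_simp

theorem norm_sum_fockMonomial_mul_conj_le {n N : ℕ} (z w : Fin n → ℂ) :
    ‖∑ α ∈ multiIndexLT n N, fockMonomial α z * conj (fockMonomial α w)‖ ≤
      Real.exp (‖z‖ * ∑ i, ‖w i‖) := by
  rw [sum_fockMonomial_mul_conj]
  have hle : ‖hermProd z w / 2‖ ≤ ‖z‖ * ∑ i, ‖w i‖ := by
    rw [norm_div]
    have := norm_hermProd_le z w
    have h0 := norm_nonneg (hermProd z w)
    norm_num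
    linarith
  calc _ ≤ ∑ k ∈ Finset.range N, ‖(hermProd z w / 2) ^ k / (k ! : ℂ)‖ := norm_sum_le _ _
    _ = ∑ k ∈ Finset.range N, ‖hermProd z w / 2‖ ^ k / (k ! : ℝ) := by
      simp only [norm_div, norm_pow, RCLike.norm_natCast]
    _ ≤ Real.exp ‖hermProd z w / 2‖ := Real.sum_le_exp_of_nonneg (norm_nonneg _) _
    _ ≤ _ := Real.exp_le_exp.2 hle

/-- Truncation by total degree turns the kernel expansion into Taylor partial sums of the
exponential. These are dominated uniformly in `N` by `exp(‖z‖ ∑ ‖w i‖)`, which is in `L²(dμ)`, as is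
`u`. -/
theorem tendsto_sum_fockCoeff {n : ℕ} {u : (Fin n → ℂ) → ℂ} (hu : MemLp u 2 (fockMeasure n))
    (z : Fin n → ℂ) :
    Filter.Tendsto (fun N => ∑ α ∈ multiIndexLT n N, fockCoeff u α * fockMonomial α z)
      Filter.atTop (nhds (fockProj u z)) := by
  have h1 : ∀ N, ∑ α ∈ multiIndexLT n N, fockCoeff u α * fockMonomial α z =
      ∫ w, u w * ∑ α ∈ multiIndexLT n N, fockMonomial α z * conj (fockMonomial α w)
        ∂(fockMeasure n) := by
    intro N
    simp only [Finset.mul_sum]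
    rw [integral_finsetSum]
    · refine Finset.sum_congr rfl fun α _ => ?_
      rw [fockCoeff, mul_comm, ← integral_const_mul]
      congr 1 with w
      ring
    · intro α _
      refine ((integrable_mul_conj_fockMonomial hu α).const_mul (fockMonomial α z)).congr
        (.of_forall fun w => ?_)
      simp only
      ring
  simp only [h1]
  refine tendsto_integral_of_dominated_convergence
    (fun w => ‖u w‖ * Real.exp (‖z‖ * ∑ i, ‖w i‖)) ?_ ?_ ?_ ?_
  · intro N
    refine hu.1.mul (Continuous.aestronglyMeasurable ?_)
    refine continuous_finsetSum _ fun α _ => ?_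
    have := continuous_fockMonomial α
    fun_prop
  · exact hu.norm.integrable_mul (memLp_exp_sum_norm ‖z‖)
  · intro N
    refine .of_forall fun w => ?_
    rw [norm_mul]
    gcongr
    exact norm_sum_fockMonomial_mul_conj_le z w
  · refine .of_forall fun w => Filter.Tendsto.const_mul _ ?_
    simp only [sum_fockMonomial_mul_conj, Complex.exp_eq_exp_ℂ]
    exact (NormedSpace.expSeries_div_hasSum_exp (hermProd z w / 2)).tendsto_sum_nat

/-- `hermProd · w` as a continuous linear form. -/
noncomputable def hermProdCLM {n : ℕ} (w : Fin n → ℂ) : (Fin n → ℂ) →L[ℂ] ℂ :=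
  ∑ i, conj (w i) • ContinuousLinearMap.proj i

theorem hermProdCLM_apply {n : ℕ} (w z : Fin n → ℂ) : hermProdCLM w z = hermProd z w := by
  simp [hermProdCLM, hermProd, mul_comm]

theorem norm_hermProdCLM_le {n : ℕ} (w : Fin n → ℂ) : ‖hermProdCLM w‖ ≤ ∑ i, ‖w i‖ :=
  ContinuousLinearMap.opNorm_le_bound _ (by positivity) fun z => by
    rw [hermProdCLM_apply, mul_comm]
    exact norm_hermProd_le z w

theorem continuous_hermProdCLM {n : ℕ} :
    Continuous (hermProdCLM : (Fin n → ℂ) → (Fin n → ℂ) →L[ℂ] ℂ) := by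
  unfold hermProdCLM; fun_prop

theorem differentiable_fockProj {n : ℕ} {u : (Fin n → ℂ) → ℂ} (hu : MemLp u 2 (fockMeasure n)) :
    Differentiable ℂ (fockProj u) := by
  intro z₀
  let K : (Fin n → ℂ) → (Fin n → ℂ) → ℂ := fun z w => Complex.exp (hermProd z w / 2)
  have hKc : ∀ z, Continuous (K z) := fun z => by
    have := continuous_hermProd z
    fun_prop
  have hK : ∀ z w, ‖K z w‖ ≤ Real.exp (‖z‖ * ∑ i, ‖w i‖) := fun z w => by
    refine (Complex.norm_exp_le_exp_norm _).trans (Real.exp_le_exp.2 ?_)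
    have := norm_hermProd_le z w
    have h0 := norm_nonneg (hermProd z w)
    rw [norm_div]
    norm_num
    linarith
  refine (hasFDerivAt_integral_of_dominated_of_fderiv_le (𝕜 := ℂ)
    (F := fun z w => u w * K z w)
    (F' := fun z w => (u w * (K z w * (1 / 2))) • hermProdCLM w)
    -- In `‖z₀‖ + 2`, one unit covers the radius of the ball and one absorbs `‖hermProdCLM w‖ ≤
    -- exp(∑ ‖w i‖)`.
    (s := Metric.ball z₀ 1) (bound := fun w => ‖u w‖ * Real.exp ((‖z₀‖ + 2) * ∑ i, ‖w i‖))
    (Metric.ball_mem_nhds z₀ one_pos) (.of_forall fun z => hu.1.mul (hKc z).aestronglyMeasurable)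
    ?_ ?_ ?_ ?_ ?_).differentiableAt
  · refine (hu.norm.integrable_mul (memLp_exp_sum_norm ‖z₀‖)).mono'
      (hu.1.mul (hKc z₀).aestronglyMeasurable) (.of_forall fun w => ?_)
    rw [norm_mul]
    exact mul_le_mul_of_nonneg_left (hK _ _) (norm_nonneg _)
  · refine (hu.1.mul (Continuous.aestronglyMeasurable ?_)).smul
      continuous_hermProdCLM.aestronglyMeasurable
    exact (hKc z₀).mul continuous_const
  · refine .of_forall fun w z hz => ?_
    have hz' : ‖z‖ ≤ ‖z₀‖ + 1 := by
      have := norm_sub_norm_le z z₀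
      rw [Metric.mem_ball, dist_eq_norm] at hz
      linarith
    have hs : 0 ≤ ∑ i, ‖w i‖ := by positivity
    rw [norm_smul, norm_mul, norm_mul, mul_assoc]
    refine mul_le_mul_of_nonneg_left ?_ (norm_nonneg _)
    calc ‖K z w‖ * ‖(1 / 2 : ℂ)‖ * ‖hermProdCLM w‖
        ≤ Real.exp ((‖z₀‖ + 1) * ∑ i, ‖w i‖) * 1 * Real.exp (∑ i, ‖w i‖) := by
          gcongr
          · exact (hK z w).trans (Real.exp_le_exp.2 (by gcongr))
          · norm_num
          · exact (norm_hermProdCLM_le w).trans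
              ((le_add_of_nonneg_right zero_le_one).trans (Real.add_one_le_exp _))
      _ = Real.exp ((‖z₀‖ + 2) * ∑ i, ‖w i‖) := by
          rw [mul_one, ← Real.exp_add]; ring_nf
  · exact hu.norm.integrable_mul (memLp_exp_sum_norm _)
  · refine .of_forall fun w z _ => ?_
    have h1 : HasFDerivAt (fun z => hermProd z w) (hermProdCLM w) z := by
      have h := (hermProdCLM w).hasFDerivAt (x := z)
      have h0 : (fun z => hermProd z w) = hermProdCLM w :=
        funext fun z => (hermProdCLM_apply w z).symm
      rwa [h0]
    have h2 := ((h1.mul_const (1 / 2 : ℂ)).cexp).const_mul (u w)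
    have h3 : (fun z => u w * Complex.exp (hermProd z w * (1 / 2))) = fun z => u w * K z w := by
      funext z
      simp only [K]
      ring_nf
    rw [h3] at h2
    refine h2.congr_fderiv ?_
    rw [smul_smul, smul_smul]
    simp only [K]
    ring_nf

/-! ### The monomials as an orthonormal family -/

/-- The monomial `ζ_α` as an element of `L²`. -/
noncomputable def fockBasis {n : ℕ} (α : Fin n → ℕ) : Lp ℂ 2 (fockMeasure n) :=
  (memLp_fockMonomial α).toLp

theorem inner_fockBasis {n : ℕ} {u : (Fin n → ℂ) → ℂ} (hu : MemLp u 2 (fockMeasure n))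
    (α : Fin n → ℕ) : inner ℂ (fockBasis α) hu.toLp = fockCoeff u α := by
  rw [L2.inner_def, fockCoeff]
  refine integral_congr_ae ?_
  filter_upwards [(memLp_fockMonomial α).coeFn_toLp, hu.coeFn_toLp] with w h1 h2
  rw [fockBasis, h1, h2, RCLike.inner_apply]

theorem fockCoeff_fockMonomial {n : ℕ} (α β : Fin n → ℕ) :
    fockCoeff (fockMonomial β) α = if α = β then 1 else 0 := by
  rw [fockCoeff, integral_fockMonomial_mul_conj]
  simp only [eq_comm]

theorem orthonormal_fockBasis (n : ℕ) :
    Orthonormal ℂ (fockBasis : (Fin n → ℕ) → Lp ℂ 2 (fockMeasure n)) := by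
  rw [orthonormal_iff_ite]
  intro α β
  conv_lhs => rw [fockBasis.eq_def β]
  rw [inner_fockBasis, fockCoeff_fockMonomial]

theorem eLpNorm_fockMonomial {n : ℕ} (α : Fin n → ℕ) :
    eLpNorm (fockMonomial α) 2 (fockMeasure n) = 1 := by
  have h := (orthonormal_fockBasis n).1 α
  rw [fockBasis, Lp.norm_toLp, ENNReal.toReal_eq_one_iff] at h
  exact h

theorem eLpNorm_sum_fockMonomial {n : ℕ} (s : Finset (Fin n → ℕ)) (c : (Fin n → ℕ) → ℂ) :
    eLpNorm (fun z => ∑ α ∈ s, c α * fockMonomial α z) 2 (fockMeasure n) =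
      ENNReal.ofReal √(∑ α ∈ s, ‖c α‖ ^ 2) := by
  have h1 : (fun z => ∑ α ∈ s, c α * fockMonomial α z) =ᵐ[fockMeasure n]
      (∑ α ∈ s, c α • fockBasis α : Lp ℂ 2 (fockMeasure n)) := by
    have h2 : ∀ᵐ z ∂(fockMeasure n), ∀ α ∈ s,
        (c α • fockBasis α : Lp ℂ 2 (fockMeasure n)) z = c α * fockMonomial α z := by
      refine (Filter.eventually_all_finset s).2 fun α _ => ?_
      filter_upwards [Lp.coeFn_smul (c α) (fockBasis α), (memLp_fockMonomial α).coeFn_toLp]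
        with z h3 h4
      rw [h3, Pi.smul_apply, fockBasis, h4, smul_eq_mul]
    filter_upwards [h2, Lp.coeFn_finsetSum s fun α => c α • fockBasis α] with z h3 h4
    rw [h4, Finset.sum_apply]
    exact Finset.sum_congr rfl fun α hα => (h3 α hα).symm
  rw [eLpNorm_congr_ae h1]
  have h5 : ‖(∑ α ∈ s, c α • fockBasis α : Lp ℂ 2 (fockMeasure n))‖ =
      √(∑ α ∈ s, ‖c α‖ ^ 2) := by
    rw [eq_comm, Real.sqrt_eq_iff_mul_self_eq (by positivity) (norm_nonneg _), ← sq]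
    have h6 := (orthonormal_fockBasis n).inner_sum c c s
    rw [inner_self_eq_norm_sq_to_K] at h6
    have h7 : ∀ α, conj (c α) * c α = ((‖c α‖ ^ 2 : ℝ) : ℂ) := fun α => by
      rw [mul_comm, Complex.mul_conj']; push_cast; rfl
    simp only [h7] at h6
    rw [RCLike.ofReal_eq_complex_ofReal, ← Complex.ofReal_pow, ← Complex.ofReal_sum] at h6
    exact (Complex.ofReal_injective h6).symm
  rw [← h5, Lp.norm_def, ENNReal.ofReal_toReal (Lp.eLpNorm_ne_top _)]

/-- Fatou along the partial sums of `fockProj u`: each has its norm computed by Pythagoras and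
bounded by Bessel's inequality for `f`. -/
theorem eLpNorm_fockProj_le {n : ℕ} {u f : (Fin n → ℂ) → ℂ} (hu : MemLp u 2 (fockMeasure n))
    (hf : MemLp f 2 (fockMeasure n)) (Λ : ℝ≥0)
    (hΛ : ∀ α, ‖fockCoeff u α‖ ≤ Λ * ‖fockCoeff f α‖) :
    eLpNorm (fockProj u) 2 (fockMeasure n) ≤ Λ * eLpNorm f 2 (fockMeasure n) := by
  refine (Lp.eLpNorm_lim_le_liminf_eLpNorm (fun N => ?_) (fockProj u)
    (.of_forall fun z => tendsto_sum_fockCoeff hu z)).trans ?_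
  · refine Continuous.aestronglyMeasurable (continuous_finsetSum _ fun α _ => ?_)
    exact continuous_const.mul (continuous_fockMonomial α)
  refine Filter.liminf_le_of_le (by isBoundedDefault) fun b hb => ?_
  obtain ⟨N, hN⟩ := hb.exists
  refine hN.trans ?_
  have h1 : eLpNorm f 2 (fockMeasure n) = ENNReal.ofReal ‖hf.toLp‖ := by
    rw [Lp.norm_toLp, ENNReal.ofReal_toReal hf.eLpNorm_ne_top]
  rw [eLpNorm_sum_fockMonomial, h1, ← ENNReal.ofReal_coe_nnreal, ← ENNReal.ofReal_mul Λ.coe_nonneg]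
  refine ENNReal.ofReal_le_ofReal (Real.sqrt_le_iff.2 ⟨by positivity, ?_⟩)
  calc ∑ α ∈ multiIndexLT n N, ‖fockCoeff u α‖ ^ 2
      ≤ ∑ α ∈ multiIndexLT n N, (Λ * ‖fockCoeff f α‖) ^ 2 := by gcongr; exact hΛ _
    _ = Λ ^ 2 * ∑ α ∈ multiIndexLT n N, ‖inner ℂ (fockBasis α) hf.toLp‖ ^ 2 := by
      simp only [mul_pow, Finset.mul_sum, inner_fockBasis]
    _ ≤ Λ ^ 2 * ‖hf.toLp‖ ^ 2 := by
      gcongr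
      exact (orthonormal_fockBasis n).sum_inner_products_le _
    _ = (Λ * ‖hf.toLp‖) ^ 2 := by ring

/-! ### Toeplitz operators with radial symbol -/

/-- The eigenvalue of the Toeplitz operator with radial symbol `g` on polynomials of degree `k`. -/
noncomputable def toeplitzEigenvalue {n : ℕ} (g : (Fin n → ℂ) → ℂ) (k : ℕ) : ℂ :=
  (∫ z, g z * (absSq z : ℂ) ^ k ∂(fockMeasure n)) / (2 ^ k * k ! * (n + k - 1).choose k)

theorem fockCoeff_radial_mul {n : ℕ} (hn : 1 ≤ n) {g f : (Fin n → ℂ) → ℂ} (hg : IsRadial g)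
    (hf : f ∈ toeplitzDomain g) (α : Fin n → ℕ) :
    fockCoeff (fun w => g w * f w) α = toeplitzEigenvalue g (∑ i, α i) * fockCoeff f α := by
  have h := integral_radial_mul_entire hn hg hf.1.1 α
    (integrable_mul_conj_fockMonomial hf.2 α) (integrable_mul_conj_fockMonomial hf.1.2 α)
  rw [integral_absSq_pow] at h
  have h1 : ((n + ∑ i, α i - 1).choose (∑ i, α i) : ℂ) ≠ 0 := by
    exact_mod_cast (Nat.choose_pos (by omega)).ne'
  have h2 : ((∑ i, α i)! : ℂ) ≠ 0 := by exact_mod_cast Nat.factorial_ne_zero _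
  rw [fockCoeff, toeplitzEigenvalue, fockCoeff, div_mul_eq_mul_div, eq_div_iff
    (mul_ne_zero (mul_ne_zero (pow_ne_zero _ two_ne_zero) h2) h1)]
  push_cast at h
  rw [h, mul_comm]

theorem toeplitz_fockMonomial {n : ℕ} (hn : 1 ≤ n) {g : (Fin n → ℂ) → ℂ} (hg : IsRadial g)
    (β : Fin n → ℕ) (hβ : fockMonomial β ∈ toeplitzDomain g) :
    toeplitz g (fockMonomial β) = fun z => toeplitzEigenvalue g (∑ i, β i) * fockMonomial β z := by
  funext z
  refine tendsto_nhds_unique (tendsto_sum_fockCoeff hβ.2 z)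
    (tendsto_const_nhds.congr' ?_)
  -- Once `N` exceeds `|β|`, the partial sums are constant: only `α = β` contributes.
  filter_upwards [Filter.eventually_gt_atTop (∑ i, β i)] with N hN
  rw [Finset.sum_eq_single β]
  · rw [fockCoeff_radial_mul hn hg hβ, fockCoeff_fockMonomial, if_pos rfl, mul_one]
  · intro α _ hα
    rw [fockCoeff_radial_mul hn hg hβ, fockCoeff_fockMonomial, if_neg hα, mul_zero, zero_mul]
  · exact fun h => absurd (mem_multiIndexLT.2 hN) h

theorem toeplitzBounded_iff {n : ℕ} (hn : 1 ≤ n) {g : (Fin n → ℂ) → ℂ} (hg : IsRadial g)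
    (hL2 : ∀ α : Fin n → ℕ, MemLp (fun z => g z * fockMonomial α z) 2 (fockMeasure n)) :
    ToeplitzBounded g ↔ ∃ C : ℝ, ∀ k, ‖toeplitzEigenvalue g k‖ ≤ C := by
  constructor
  · rintro ⟨C, hC⟩
    refine ⟨C, fun k => ?_⟩
    -- Any multi-index of weight `k` would do: its monomial is a unit eigenvector for the `k`-th
    -- eigenvalue.
    let β : Fin n → ℕ := Pi.single ⟨0, hn⟩ k
    have hsum : ∑ i, β i = k := by simp [β]
    have hβ : fockMonomial β ∈ toeplitzDomain g := ⟨fockMonomial_mem_fockSpace β, hL2 β⟩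
    have h := (hC _ hβ).2
    rw [toeplitz_fockMonomial hn hg β hβ, hsum, eLpNorm_fockMonomial, mul_one] at h
    have h2 : eLpNorm (fun z => toeplitzEigenvalue g k * fockMonomial β z) 2 (fockMeasure n) =
        ‖toeplitzEigenvalue g k‖ₑ := by
      have := eLpNorm_const_smul (toeplitzEigenvalue g k) (fockMonomial β) 2 (fockMeasure n)
      rw [eLpNorm_fockMonomial, mul_one] at this
      exact this
    rw [h2] at h
    exact_mod_cast h
  · rintro ⟨C, hC⟩
    refine ⟨C.toNNReal, fun f hf => ?_⟩
    have hle : eLpNorm (toeplitz g f) 2 (fockMeasure n) ≤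
        C.toNNReal * eLpNorm f 2 (fockMeasure n) := by
      refine eLpNorm_fockProj_le hf.2 hf.1.2 _ fun α => ?_
      rw [fockCoeff_radial_mul hn hg hf, norm_mul]
      gcongr
      exact (hC _).trans (Real.le_coe_toNNReal C)
    have hd := differentiable_fockProj hf.2
    refine ⟨⟨hd, hd.continuous.aestronglyMeasurable, hle.trans_lt ?_⟩, hle⟩
    exact ENNReal.mul_lt_top ENNReal.coe_lt_top hf.1.2.eLpNorm_lt_top

/-! ### Laguerre polynomials -/

section LaguerreSeries

open PowerSeries

/-- The power series of `exp(x t / (1 - t))`. -/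
noncomputable def laguerreExp (x : ℝ) : ℝ⟦X⟧ := (rescale x (exp ℝ)).subst (X * mk 1 : ℝ⟦X⟧)

theorem hasSubst_X_mul_geom : HasSubst (X * mk 1 : ℝ⟦X⟧) :=
  HasSubst.of_constantCoeff_zero' (by simp)

theorem laguerreExp_add (x y : ℝ) : laguerreExp (x + y) = laguerreExp x * laguerreExp y := by
  rw [laguerreExp, ← exp_mul_exp_eq_exp_add, subst_mul hasSubst_X_mul_geom]
  rfl

theorem laguerreExp_zero : laguerreExp 0 = 1 := by
  have : rescale (0 : ℝ) (exp ℝ) = 1 := by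
    ext k
    rw [coeff_rescale, coeff_exp, coeff_one]
    rcases eq_or_ne k 0 with rfl | hk <;> simp [*]
  rw [laguerreExp, this, ← coe_substAlgHom hasSubst_X_mul_geom, map_one]

theorem coeff_X_mul_geom_pow_of_lt {k d : ℕ} (h : k < d) :
    coeff k ((X * mk 1 : ℝ⟦X⟧) ^ d) = 0 := by
  rw [mul_pow, coeff_X_pow_mul', if_neg (by omega)]

/-- The cutoff `m` is free so that all coefficients in a Cauchy product can share one range of
summation. -/
theorem coeff_laguerreExp {k m : ℕ} (h : k ≤ m) (x : ℝ) :
    coeff k (laguerreExp x) =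
      ∑ d ∈ Finset.range (m + 1), x ^ d / d ! * coeff k ((X * mk 1 : ℝ⟦X⟧) ^ d) := by
  rw [laguerreExp, coeff_subst' hasSubst_X_mul_geom, finsum_eq_sum_of_support_subset (s :=
    Finset.range (m + 1))]
  · refine Finset.sum_congr rfl fun d _ => ?_
    rw [coeff_rescale, coeff_exp, smul_eq_mul]
    simp [div_eq_mul_inv]
  · intro d hd
    by_contra hc
    refine hd ?_
    have hc' : m + 1 ≤ d := by simpa using hc
    simp only [coeff_X_mul_geom_pow_of_lt (show k < d by omega), smul_zero]

/-- The generating function `∑ L_k^a(x) t^k = (1 - t)^{-a-1} exp(-x t / (1 - t))`, with `mk 1` as `1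
/ (1 - t)`. -/
theorem coeff_geom_pow_mul_laguerreExp (k a : ℕ) (x : ℝ) :
    coeff k ((mk 1 : ℝ⟦X⟧) ^ (a + 1) * laguerreExp (-x)) = laguerre k a x := by
  have h1 : coeff k ((mk 1 : ℝ⟦X⟧) ^ (a + 1) * laguerreExp (-x)) = ∑ d ∈ Finset.range (k + 1),
      (-x) ^ d / d ! * coeff k ((mk 1 : ℝ⟦X⟧) ^ (a + 1) * (X * mk 1 : ℝ⟦X⟧) ^ d) := by
    simp only [coeff_mul, Finset.mul_sum]
    rw [Finset.sum_comm]
    refine Finset.sum_congr rfl fun p hp => ?_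
    rw [coeff_laguerreExp (show p.2 ≤ k by have := Finset.HasAntidiagonal.mem_antidiagonal.1 hp; omega), Finset.mul_sum]
    exact Finset.sum_congr rfl fun d _ => by ring
  rw [h1, laguerre]
  refine Finset.sum_congr rfl fun d hd => ?_
  have hdk : d ≤ k := Nat.lt_succ_iff.1 (Finset.mem_range.1 hd)
  have h2 : (mk 1 : ℝ⟦X⟧) ^ (a + 1) * (X * mk 1 : ℝ⟦X⟧) ^ d = X ^ d * mk 1 ^ (a + d + 1) := by ring
  rw [h2, coeff_X_pow_mul', if_pos hdk, mk_one_pow_eq_mk_choose_add, coeff_mk,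
    show a + d + (k - d) = k + a by omega, Nat.choose_symm_of_eq_add (show k + a = a + d + (k - d) by omega),
    neg_pow]
  ring

/-- Multiplying type-`0` generating functions adds the arguments and collects powers of `1 / (1 -
t)`; `n` factors give type `n - 1`. -/
theorem prod_geom_mul_laguerreExp {ι : Type*} (s : Finset ι) (x : ι → ℝ) :
    ∏ i ∈ s, (mk fun k => laguerre k 0 (x i)) =
      (mk 1 : ℝ⟦X⟧) ^ s.card * laguerreExp (-∑ i ∈ s, x i) := by
  classical
  have h : ∀ y : ℝ, (mk fun k => laguerre k 0 y) = mk 1 * laguerreExp (-y) := fun y => by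
    ext k
    rw [coeff_mk, ← coeff_geom_pow_mul_laguerreExp, zero_add, pow_one]
  induction s using Finset.induction_on with
  | empty => simp [laguerreExp_zero]
  | insert i s hi ih =>
    rw [Finset.prod_insert hi, ih, h, Finset.card_insert_of_notMem hi, Finset.sum_insert hi,
      neg_add, laguerreExp_add]
    ring

/-- The addition formula for Laguerre polynomials. -/
theorem laguerre_sum {n : ℕ} (hn : 1 ≤ n) (k : ℕ) (x : Fin n → ℝ) :
    laguerre k (n - 1) (∑ i, x i) =
      ∑ α ∈ Finset.piAntidiag Finset.univ k, ∏ i, laguerre (α i) 0 (x i) := by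
  have h := congrArg (coeff k) (prod_geom_mul_laguerreExp Finset.univ x)
  have h2 := coeff_geom_pow_mul_laguerreExp k (n - 1) (∑ i, x i)
  rw [Nat.sub_add_cancel hn] at h2
  rw [Finset.card_univ, Fintype.card_fin, h2, coeff_prod] at h
  rw [← h]
  symm
  refine Finset.sum_bij (fun f _ => Finsupp.equivFunOnFinite.symm f) ?_ ?_ ?_ ?_
  · intro f hf
    simpa using hf
  · intro f _ f' _ hff
    exact Finsupp.equivFunOnFinite.symm.injective hff
  · intro f hf
    exact ⟨f, by simpa using hf, by simp⟩
  · intro f _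
    simp

end LaguerreSeries

/-- As `C(m,j) C(j,p) = C(m,p) C(m-p,j-p)`, what remains is the binomial expansion of `(1 -
1)^(m-p)`. -/
theorem alternating_sum_choose_mul_choose (m p : ℕ) :
    ∑ j ∈ Finset.range (m + 1), (-1 : ℝ) ^ j * m.choose j * j.choose p =
      if p = m then (-1) ^ m else 0 := by
  rcases lt_or_ge m p with hp | hp
  · rw [if_neg hp.ne']
    refine Finset.sum_eq_zero fun j hj => ?_
    rw [Nat.choose_eq_zero_of_lt (show j < p by have := Finset.mem_range.1 hj; omega)]
    simp
  obtain ⟨q, rfl⟩ := Nat.exists_eq_add_of_le hp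
  rw [show p + q + 1 = p + (q + 1) by ring, Finset.sum_range_add]
  rw [Finset.sum_eq_zero fun j hj => by
    rw [Nat.choose_eq_zero_of_lt (Finset.mem_range.1 hj)]; simp, zero_add]
  have h1 : ∀ i ∈ Finset.range (q + 1), (-1 : ℝ) ^ (p + i) * (p + q).choose (p + i) *
      (p + i).choose p = (-1) ^ p * (p + q).choose p * ((-1) ^ i * q.choose i) := fun i hi => by
    have := Nat.choose_mul (n := p + q) (k := p + i) (s := p) (by omega)
    simp only [Nat.add_sub_cancel_left] at this
    have h2 : ((p + q).choose (p + i) : ℝ) * (p + i).choose p = (p + q).choose p * q.choose i := by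
      exact_mod_cast this
    rw [mul_assoc, h2]
    ring
  rw [Finset.sum_congr rfl h1, ← Finset.mul_sum]
  have h3 := Int.alternating_sum_range_choose (n := q)
  have h4 : ∑ i ∈ Finset.range (q + 1), (-1 : ℝ) ^ i * q.choose i = if q = 0 then 1 else 0 := by
    exact_mod_cast congrArg (Int.cast : ℤ → ℝ) h3
  rw [h4]
  rcases eq_or_ne q 0 with rfl | hq
  · simp
  · simp [hq]

theorem integrable_norm_add_pow (z : ℂ) (j : ℕ) :
    Integrable (fun y : ℂ => ‖z + y‖ ^ j) planeGaussian := by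
  refine Integrable.mono' ((integrable_exp_norm_planeGaussian 1).const_mul (j ! * Real.exp ‖z‖))
    (Continuous.aestronglyMeasurable (by fun_prop)) (.of_forall fun y => ?_)
  rw [Real.norm_of_nonneg (by positivity), mul_assoc, ← Real.exp_add, one_mul]
  refine (norm_pow_le_exp j _).trans ?_
  gcongr
  exact norm_add_le z y

/-- Expand `(z + y)^j (z̄ + ȳ)^j`; orthogonality of the powers of `y` leaves only the diagonal
terms. -/
theorem integral_norm_add_pow (z : ℂ) (j : ℕ) :
    ∫ y : ℂ, (‖z + y‖ ^ 2 / 2) ^ j / j ! ∂planeGaussian =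
      ∑ p ∈ Finset.range (j + 1), j.choose p * (‖z‖ ^ 2 / 2) ^ p / p ! := by
  have h1 : ∀ y : ℂ, (((‖z + y‖ ^ 2 / 2) ^ j / j ! : ℝ) : ℂ) =
      ∑ a ∈ Finset.range (j + 1), ∑ b ∈ Finset.range (j + 1),
        (z ^ a * j.choose a * (conj z ^ b * j.choose b) / (2 ^ j * j !)) *
          (y ^ (j - a) * conj y ^ (j - b)) := by
    intro y
    have : (((‖z + y‖ ^ 2 / 2) ^ j / j ! : ℝ) : ℂ) =
        ((z + y) ^ j * (conj z + conj y) ^ j) / (2 ^ j * j !) := by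
      push_cast
      rw [← Complex.mul_conj', map_add, div_pow, mul_pow]
      ring
    rw [this, add_pow, add_pow, Finset.sum_mul_sum, Finset.sum_div]
    refine Finset.sum_congr rfl fun a _ => ?_
    rw [Finset.sum_div]
    exact Finset.sum_congr rfl fun b _ => by ring
  have h2 : ∫ y : ℂ, (((‖z + y‖ ^ 2 / 2) ^ j / j ! : ℝ) : ℂ) ∂planeGaussian =
      ((∑ p ∈ Finset.range (j + 1), j.choose p * (‖z‖ ^ 2 / 2) ^ p / p ! : ℝ) : ℂ) := by
    simp only [h1]
    rw [integral_finsetSum _ fun a _ => integrable_finsetSum _ fun b _ =>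
      (integrable_pow_mul_conj_pow _ _).const_mul _]
    rw [Complex.ofReal_sum]
    refine Finset.sum_congr rfl fun a ha => ?_
    have haj : a ≤ j := Nat.lt_succ_iff.1 (Finset.mem_range.1 ha)
    rw [integral_finsetSum _ fun b _ => (integrable_pow_mul_conj_pow _ _).const_mul _]
    simp only [integral_const_mul, integral_pow_mul_conj_pow]
    rw [Finset.sum_eq_single a]
    · rw [if_pos rfl]
      have hc : (j.choose a : ℂ) * a ! * (j - a)! = j ! := by
        exact_mod_cast Nat.choose_mul_factorial_mul_factorial haj
      have h3 : (a ! : ℂ) ≠ 0 := by exact_mod_cast a.factorial_ne_zero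
      have h4 : ((j - a)! : ℂ) ≠ 0 := by exact_mod_cast (j - a).factorial_ne_zero
      have h5 : (j.choose a : ℂ) ≠ 0 := by exact_mod_cast (Nat.choose_pos haj).ne'
      have h6 : (2 : ℂ) ^ j = 2 ^ a * 2 ^ (j - a) := by rw [← pow_add, Nat.add_sub_cancel' haj]
      push_cast
      rw [← hc, ← Complex.mul_conj', div_pow, mul_pow, h6]
      field_simp
    · intro b hb hba
      have : b ≤ j := Nat.lt_succ_iff.1 (Finset.mem_range.1 hb)
      rw [if_neg (by omega), mul_zero]
    · exact fun h => absurd ha h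
  rw [integral_complex_ofReal] at h2
  exact_mod_cast h2

theorem continuous_laguerre (k a : ℕ) : Continuous (laguerre k a) := by
  unfold laguerre; fun_prop

theorem integrable_laguerre_zero (m : ℕ) (z : ℂ) :
    Integrable (fun y : ℂ => laguerre m 0 (‖z + y‖ ^ 2 / 2)) planeGaussian := by
  unfold laguerre
  refine integrable_finsetSum _ fun j _ => ?_
  refine ((integrable_norm_add_pow z (2 * j)).const_mul
    ((-1) ^ j * ((m + 0).choose (m - j) : ℝ) / (2 ^ j * j !))).congr (.of_forall fun y => ?_)
  simp only [div_pow, pow_mul]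
  field_simp

/-- Averaging each power and exchanging the sums produces an alternating binomial sum, which kills
every degree except the top one. -/
theorem integral_laguerre_zero (m : ℕ) (z : ℂ) :
    ∫ y : ℂ, laguerre m 0 (‖z + y‖ ^ 2 / 2) ∂planeGaussian =
      (-1) ^ m * (‖z‖ ^ 2 / 2) ^ m / m ! := by
  have h1 : ∀ y : ℂ, laguerre m 0 (‖z + y‖ ^ 2 / 2) = ∑ j ∈ Finset.range (m + 1),
      (-1) ^ j * (m.choose j : ℝ) * ((‖z + y‖ ^ 2 / 2) ^ j / j !) := fun y => by
    refine Finset.sum_congr rfl fun j hj => ?_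
    rw [add_zero, Nat.choose_symm (Nat.lt_succ_iff.1 (Finset.mem_range.1 hj))]
    ring
  simp only [h1]
  rw [integral_finsetSum]
  · simp only [integral_const_mul, integral_norm_add_pow]
    have h2 : ∀ j ∈ Finset.range (m + 1), (-1 : ℝ) ^ j * (m.choose j : ℝ) *
        ∑ p ∈ Finset.range (j + 1), j.choose p * (‖z‖ ^ 2 / 2) ^ p / p ! =
        ∑ p ∈ Finset.range (m + 1), ((-1 : ℝ) ^ j * m.choose j * j.choose p) *
          ((‖z‖ ^ 2 / 2) ^ p / p !) := fun j hj => by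
      rw [Finset.mul_sum]
      rw [Finset.sum_subset (Finset.range_mono (show j + 1 ≤ m + 1 from
        Finset.mem_range.1 hj))]
      · exact Finset.sum_congr rfl fun p _ => by ring
      · intro p _ hp
        rw [Nat.choose_eq_zero_of_lt (show j < p by simpa using hp)]
        simp
    rw [Finset.sum_congr rfl h2, Finset.sum_comm]
    simp only [← Finset.sum_mul, alternating_sum_choose_mul_choose]
    rw [Finset.sum_eq_single m]
    · rw [if_pos rfl]; ring
    · intro p _ hp
      rw [if_neg hp, zero_mul]
    · intro h; simp at h
  · intro j _
    refine ((integrable_norm_add_pow z (2 * j)).const_mul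
      ((-1) ^ j * (m.choose j : ℝ) / (2 ^ j * j !))).congr (.of_forall fun y => ?_)
    simp only [div_pow, pow_mul]
    field_simp

/-- The Gaussian average of the translates of a Laguerre polynomial of `|z|²/2` is a monomial
in `|z|²/2`. -/
theorem integral_laguerre_absSq {n : ℕ} (hn : 1 ≤ n) (k : ℕ) (z : Fin n → ℂ) :
    ∫ y, laguerre k (n - 1) (absSq (z + y) / 2) ∂(fockMeasure n) =
      (-1) ^ k * (absSq z / 2) ^ k / k ! := by
  -- The addition formula splits the integrand into coordinates; the multinomial theorem reassembles
  -- the resulting monomials.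
  have h1 : ∀ y : Fin n → ℂ, laguerre k (n - 1) (absSq (z + y) / 2) =
      ∑ α ∈ Finset.piAntidiag Finset.univ k, ∏ i, laguerre (α i) 0 (‖z i + y i‖ ^ 2 / 2) :=
    fun y => by rw [← laguerre_sum hn, absSq, Finset.sum_div]; rfl
  simp only [h1]
  have hint : ∀ α : Fin n → ℕ, Integrable (fun y : Fin n → ℂ =>
      ∏ i, laguerre (α i) 0 (‖z i + y i‖ ^ 2 / 2)) (fockMeasure n) := fun α =>
    integrable_fockMeasure_prod (f := fun i y => laguerre (α i) 0 (‖z i + y‖ ^ 2 / 2))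
      fun i => integrable_laguerre_zero (α i) (z i)
  rw [integral_finsetSum _ fun α _ => hint α]
  rw [absSq, Finset.sum_div, Finset.sum_pow_eq_sum_piAntidiag, Finset.mul_sum, Finset.sum_div]
  refine Finset.sum_congr rfl fun α hα => ?_
  rw [integral_fockMeasure_prod (f := fun i y => laguerre (α i) 0 (‖z i + y‖ ^ 2 / 2))]
  simp only [integral_laguerre_zero, Finset.prod_div_distrib, Finset.prod_mul_distrib,
    Finset.prod_pow_eq_pow_sum]
  have hk : ∑ i, α i = k := (Finset.mem_piAntidiag.1 hα).1
  have hm := Nat.multinomial_spec Finset.univ α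
  rw [hk] at hm
  rw [hk, ← hm]
  have h2 : ((∏ i, (α i)! : ℕ) : ℝ) ≠ 0 := by
    exact_mod_cast Finset.prod_ne_zero_iff.2 fun i _ => (α i).factorial_ne_zero
  have h3 : (Nat.multinomial Finset.univ α : ℝ) ≠ 0 := by
    exact_mod_cast (Nat.multinomial_pos _ _).ne'
  push_cast at h2 ⊢
  field_simp

/-! ### The convolution with the heat kernel -/

theorem absSq_add_add_absSq_sub {n : ℕ} (z w : Fin n → ℂ) :
    absSq (z + w) + absSq (z - w) = 2 * (absSq z + absSq w) := by
  simp only [absSq, ← Finset.sum_add_distrib, Finset.mul_sum]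
  refine Finset.sum_congr rfl fun i _ => ?_
  have := parallelogram_law_with_norm ℝ (z i) (w i)
  simp only [Pi.add_apply, Pi.sub_apply]
  linarith

theorem absSq_add_le {n : ℕ} (z w : Fin n → ℂ) : absSq (z + w) ≤ 2 * (absSq z + absSq w) := by
  have := absSq_add_add_absSq_sub z w
  have := absSq_nonneg (z - w)
  linarith

theorem heatKernel_quarter {n : ℕ} (z : Fin n → ℂ) :
    heatKernel n (1 / 4) z = (((Real.pi ^ n)⁻¹ * Real.exp (-absSq z) : ℝ) : ℂ) := by
  unfold heatKernel
  congr 3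
  · ring
  · norm_num

theorem continuous_heatKernel (n : ℕ) (t : ℝ) : Continuous (heatKernel n t) := by
  have := continuous_absSq (n := n)
  unfold heatKernel; fun_prop

/-- For fixed `w` the quotient of `q_{1/4}(w - t)` by the Gaussian density is bounded in `t`,
because `|t|²/2 ≤ |w - t|² + |w|²`. -/
theorem convolutionExistsAt_heatKernel {n : ℕ} {g : (Fin n → ℂ) → ℂ}
    (hg : Integrable g (fockMeasure n)) (w : Fin n → ℂ) :
    ConvolutionExistsAt g (heatKernel n (1 / 4)) w (ContinuousLinearMap.mul ℂ ℂ) volume := by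
  have h1 := integrable_fockMeasure_iff.1 hg
  have hρ : ∀ t : Fin n → ℂ, (fockDensity t : ℂ) ≠ 0 := fun t => by
    exact_mod_cast (fockDensity_pos t).ne'
  have hc : Continuous fun t => (fockDensity t : ℂ)⁻¹ * heatKernel n (1 / 4) (w - t) :=
    ((Complex.continuous_ofReal.comp continuous_fockDensity).inv₀ hρ).mul
      ((continuous_heatKernel n _).comp (by fun_prop))
  have h2 := h1.bdd_mul (c := 2 ^ n * Real.exp (absSq w)) hc.aestronglyMeasurable
    (.of_forall fun t => ?_)
  · refine h2.congr (.of_forall fun t => ?_)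
    have := hρ t
    simp only [Complex.real_smul, ContinuousLinearMap.mul_apply']
    field_simp
  · have h3 : absSq t ≤ 2 * (absSq (w - t) + absSq w) := by
      have := absSq_add_le (t - w) w
      have h4 : absSq (t - w) = absSq (w - t) := by
        simp [absSq, norm_sub_rev]
      rwa [sub_add_cancel, h4] at this
    rw [norm_mul, norm_inv, heatKernel_quarter, Complex.norm_real, Complex.norm_real,
      Real.norm_of_nonneg (fockDensity_pos t).le, Real.norm_of_nonneg (by positivity), fockDensity,
      mul_inv, inv_inv, ← Real.exp_neg, mul_pow]
    have hpi := Real.pi_pos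
    calc 2 ^ n * Real.pi ^ n * Real.exp (-(-absSq t / 2)) *
          ((Real.pi ^ n)⁻¹ * Real.exp (-absSq (w - t)))
        = 2 ^ n * (Real.exp (-(-absSq t / 2)) * Real.exp (-absSq (w - t))) := by field_simp
      _ ≤ 2 ^ n * Real.exp (absSq w) := by
          rw [← Real.exp_add]
          gcongr
          linarith

theorem exists_abs_laguerre_le (k a : ℕ) :
    ∃ C : ℝ, ∀ x : ℝ, 0 ≤ x → |laguerre k a x| ≤ C * (1 + x) ^ k := by
  refine ⟨∑ j ∈ Finset.range (k + 1), ((k + a).choose (k - j) : ℝ) / j !, fun x hx => ?_⟩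
  rw [laguerre, Finset.sum_mul]
  refine (Finset.abs_sum_le_sum_abs _ _).trans (Finset.sum_le_sum fun j hj => ?_)
  have hjk : j ≤ k := Nat.lt_succ_iff.1 (Finset.mem_range.1 hj)
  rw [abs_div, abs_mul, abs_mul, abs_pow, abs_neg, abs_one, one_pow, one_mul, abs_pow,
    abs_of_nonneg hx, Nat.abs_cast, Nat.abs_cast, mul_div_right_comm]
  gcongr
  calc x ^ j ≤ (1 + x) ^ j := by gcongr; linarith
    _ ≤ (1 + x) ^ k := pow_le_pow_right₀ (by linarith) hjk

/-- After a linear change of variables, the double integral defining the Laguerre coefficients has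
a Gaussian weight in each variable. -/
theorem heatKernel_mul_laguerreFn {n : ℕ} (k : ℕ) (z u : Fin n → ℂ) :
    heatKernel n (1 / 4) ((2 : ℝ)⁻¹ • u - z) * laguerreFn n k u =
      (((4 * Real.pi) ^ n * fockDensity z * (fockDensity (u - z) *
        laguerre k (n - 1) (absSq (z + (u - z)) / 2)) : ℝ) : ℂ) := by
  -- Parallelogram law for `u/2` and `u/2 - z`, whose sum is `u - z` and whose difference is `z`.
  have h1 : absSq ((2 : ℝ)⁻¹ • u - z) + absSq u / 4 = (absSq z + absSq (u - z)) / 2 := by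
    have h2 := absSq_add_add_absSq_sub ((2 : ℝ)⁻¹ • u) ((2 : ℝ)⁻¹ • u - z)
    have h3 : (2 : ℝ)⁻¹ • u + ((2 : ℝ)⁻¹ • u - z) = u - z := by
      ext i; simp; ring
    rw [h3, sub_sub_cancel, absSq_real_smul] at h2
    norm_num at h2
    linarith
  rw [heatKernel_quarter, laguerreFn, ← Complex.ofReal_mul, add_sub_cancel]
  congr 1
  unfold fockDensity
  have hpi := Real.pi_pos
  have h4 : Real.exp (-absSq ((2 : ℝ)⁻¹ • u - z)) * Real.exp (-absSq u / 4) =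
      Real.exp (-absSq z / 2) * Real.exp (-absSq (u - z) / 2) := by
    rw [← Real.exp_add, ← Real.exp_add]
    congr 1
    linarith
  calc _ = (Real.pi ^ n)⁻¹ * laguerre k (n - 1) (absSq u / 2) *
        (Real.exp (-absSq ((2 : ℝ)⁻¹ • u - z)) * Real.exp (-absSq u / 4)) := by ring
    _ = _ := by
      rw [h4]
      have : (4 : ℝ) ^ n = 2 ^ n * 2 ^ n := by rw [← mul_pow]; norm_num
      rw [mul_pow, mul_pow, this]
      field_simp

section Fubini

variable {n : ℕ} {g : (Fin n → ℂ) → ℂ}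

/-- The Laguerre factor is at most `C (1 + |z|²)^k (1 + |v|²)^k`, so the majorant is a product; its
`g` factor is integrable by Cauchy–Schwarz. -/
theorem integrable_fockDensity_mul_laguerre (hg : MemLp g 2 (fockMeasure n)) (k : ℕ) :
    Integrable (fun p : (Fin n → ℂ) × (Fin n → ℂ) => g p.1 *
      (((4 * Real.pi) ^ n * fockDensity p.1 * (fockDensity p.2 *
        laguerre k (n - 1) (absSq (p.1 + p.2) / 2)) : ℝ) : ℂ)) (volume.prod volume) := by
  obtain ⟨C, hC⟩ := exists_abs_laguerre_le k (n - 1)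
  have hC0 : 0 ≤ C := by
    have := (abs_nonneg _).trans (hC 0 le_rfl)
    simpa using this
  have h1 : Integrable fun z => fockDensity z • (‖g z‖ * (1 + absSq z) ^ k) :=
    integrable_fockMeasure_iff.1 (hg.norm.integrable_mul (memLp_one_add_absSq_pow k))
  have h2 : Integrable fun z : Fin n → ℂ => fockDensity z • (1 + absSq z) ^ k :=
    integrable_fockMeasure_iff.1 ((memLp_one_add_absSq_pow k).integrable one_le_two)
  -- Dividing by the positive density transfers measurability from `μ` to Lebesgue measure.
  have hgm : AEStronglyMeasurable g volume := by
    have h3 := (integrable_fockMeasure_iff.1 (hg.integrable one_le_two)).1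
    have h4 : AEStronglyMeasurable (fun z => (fockDensity z)⁻¹ • fockDensity z • g z) volume :=
      (continuous_fockDensity.inv₀ fun z => (fockDensity_pos z).ne').aestronglyMeasurable.smul h3
    refine h4.congr (.of_forall fun z => ?_)
    simp only [smul_smul, inv_mul_cancel₀ (fockDensity_pos z).ne', one_smul]
  have hca := continuous_absSq (n := n)
  have hcl := continuous_laguerre k (n - 1)
  have hcd := continuous_fockDensity (n := n)
  refine ((h1.mul_prod h2).const_mul ((4 * Real.pi) ^ n * C)).mono' ?_ (.of_forall fun p => ?_)
  · exact hgm.comp_fst.mul (Continuous.aestronglyMeasurable (by fun_prop))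
  · have hp1 := absSq_nonneg p.1
    have hp2 := absSq_nonneg p.2
    have hd1 := (fockDensity_pos p.1).le
    have hd2 := (fockDensity_pos p.2).le
    have hle : |laguerre k (n - 1) (absSq (p.1 + p.2) / 2)| ≤
        C * ((1 + absSq p.1) ^ k * (1 + absSq p.2) ^ k) := by
      refine (hC _ (by have := absSq_nonneg (p.1 + p.2); positivity)).trans ?_
      rw [← mul_pow]
      have := absSq_nonneg (p.1 + p.2)
      gcongr
      nlinarith [absSq_add_le p.1 p.2, mul_nonneg hp1 hp2]
    rw [norm_mul, Complex.norm_real, Real.norm_eq_abs, abs_mul, abs_mul, abs_mul,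
      abs_of_nonneg hd1, abs_of_nonneg hd2, abs_of_nonneg (by positivity : 0 ≤ (4 * Real.pi) ^ n)]
    calc ‖g p.1‖ * ((4 * Real.pi) ^ n * fockDensity p.1 * (fockDensity p.2 *
          |laguerre k (n - 1) (absSq (p.1 + p.2) / 2)|))
        ≤ ‖g p.1‖ * ((4 * Real.pi) ^ n * fockDensity p.1 * (fockDensity p.2 *
          (C * ((1 + absSq p.1) ^ k * (1 + absSq p.2) ^ k)))) := by gcongr
      _ = _ := by simp only [smul_eq_mul]; ring

theorem measurePreserving_prod_sub (n : ℕ) :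
    MeasurePreserving (fun p : (Fin n → ℂ) × (Fin n → ℂ) => (p.1, p.2 - p.1))
      (volume.prod volume) (volume.prod volume) :=
  (MeasurePreserving.id volume).skew_product (g := fun z u : Fin n → ℂ => u - z)
    (Continuous.measurable (by fun_prop))
    (.of_forall fun z => (measurePreserving_sub_right volume z).map_eq)

/-- The measure-preserving shear `(z, u) ↦ (z, u - z)` carries the Gaussian form of the integrand to
this one. -/
theorem integrable_heatKernel_mul_laguerreFn (hg : MemLp g 2 (fockMeasure n)) (k : ℕ) :
    Integrable (fun p : (Fin n → ℂ) × (Fin n → ℂ) =>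
      g p.1 * heatKernel n (1 / 4) ((2 : ℝ)⁻¹ • p.2 - p.1) * laguerreFn n k p.2)
      (volume.prod volume) := by
  refine ((measurePreserving_prod_sub n).integrable_comp_of_integrable
    (integrable_fockDensity_mul_laguerre hg k)).congr (.of_forall fun p => ?_)
  simp only [Function.comp_apply, mul_assoc (g p.1), heatKernel_mul_laguerreFn]

theorem heatFlow_mul_laguerreFn (k : ℕ) (u : Fin n → ℂ) :
    heatFlow (1 / 4) g ((2 : ℝ)⁻¹ • u) * laguerreFn n k u =
      ∫ z, g z * heatKernel n (1 / 4) ((2 : ℝ)⁻¹ • u - z) * laguerreFn n k u := by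
  rw [integral_mul_const]
  rfl

theorem heatFlow_mul_laguerreFn_two_smul (k : ℕ) (w : Fin n → ℂ) :
    heatFlow (1 / 4) g w * laguerreFn n k ((2 : ℂ) • w) =
      heatFlow (1 / 4) g ((2 : ℝ)⁻¹ • (2 : ℝ) • w) * laguerreFn n k ((2 : ℝ) • w) := by
  rw [inv_smul_smul₀ two_ne_zero]
  congr 2

theorem integrable_heatFlow_mul_laguerreFn (hg : MemLp g 2 (fockMeasure n)) (k : ℕ) :
    Integrable (fun w : Fin n → ℂ => heatFlow (1 / 4) g w * laguerreFn n k ((2 : ℂ) • w))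
      volume := by
  have h1 := (integrable_heatKernel_mul_laguerreFn hg k).integral_prod_right
  simp only [← heatFlow_mul_laguerreFn] at h1
  simp only [heatFlow_mul_laguerreFn_two_smul]
  exact h1.comp_smul (R := (2 : ℝ)) two_ne_zero

/-- Substituting `u = 2w` costs `4^{-n}`, as the real dimension is `2n`. After Fubini the inner
integral over `v = u - z` is a Gaussian average of a Laguerre polynomial, and `4^{-n} (4π)^n = π^n`.
-/
theorem integral_heatFlow_mul_laguerreFn (hn : 1 ≤ n) (hg : MemLp g 2 (fockMeasure n)) (k : ℕ) :
    ∫ w : Fin n → ℂ, heatFlow (1 / 4) g w * laguerreFn n k ((2 : ℂ) • w) =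
      Real.pi ^ n * ((-1) ^ k / (2 ^ k * k !)) *
        ∫ z, g z * (absSq z : ℂ) ^ k ∂(fockMeasure n) := by
  have h1 : ∫ w : Fin n → ℂ, heatFlow (1 / 4) g w * laguerreFn n k ((2 : ℂ) • w) =
      ((4 : ℝ) ^ n)⁻¹ • ∫ u : Fin n → ℂ,
        heatFlow (1 / 4) g ((2 : ℝ)⁻¹ • u) * laguerreFn n k u := by
    have h := Measure.integral_comp_smul (volume : Measure (Fin n → ℂ))
      (fun u => heatFlow (1 / 4) g ((2 : ℝ)⁻¹ • u) * laguerreFn n k u) 2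
    have hdim : Module.finrank ℝ (Fin n → ℂ) = 2 * n := by
      rw [Module.finrank_pi_fintype]
      simp [mul_comm]
    simp only [heatFlow_mul_laguerreFn_two_smul]
    rw [h, hdim, pow_mul, abs_of_pos (by positivity)]
    norm_num
  have h2 : ∫ u : Fin n → ℂ, heatFlow (1 / 4) g ((2 : ℝ)⁻¹ • u) * laguerreFn n k u =
      ∫ z, g z * (((4 * Real.pi) ^ n * fockDensity z *
        ((-1) ^ k * (absSq z / 2) ^ k / k !) : ℝ) : ℂ) := by
    simp only [heatFlow_mul_laguerreFn]
    rw [← integral_integral_swap (f := fun z u => g z *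
      heatKernel n (1 / 4) ((2 : ℝ)⁻¹ • u - z) * laguerreFn n k u)
      (integrable_heatKernel_mul_laguerreFn hg k)]
    congr 1 with z
    simp only [mul_assoc (g z), heatKernel_mul_laguerreFn]
    rw [integral_const_mul, integral_complex_ofReal, integral_const_mul,
      integral_sub_right_eq_self (fun v => fockDensity v *
        laguerre k (n - 1) (absSq (z + v) / 2)) z, ← integral_laguerre_absSq hn,
      integral_fockMeasure]
    rfl
  rw [h1, h2, integral_fockMeasure, ← integral_const_mul, ← integral_smul]
  congr 1 with z
  simp only [Complex.real_smul]
  push_cast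
  rw [mul_pow, div_pow]
  field_simp

end Fubini

/-! ### Laguerre coefficients as Toeplitz eigenvalues -/

theorem laguerreCoeff_eq {n : ℕ} (hn : 1 ≤ n) {g : (Fin n → ℂ) → ℂ}
    (hg : MemLp g 2 (fockMeasure n)) (k : ℕ) :
    laguerreCoeff g k = (-1) ^ k * Real.pi ^ n * toeplitzEigenvalue g k := by
  rw [laguerreCoeff, integral_heatFlow_mul_laguerreFn hn hg, toeplitzEigenvalue]
  -- The prefactor of the sequence is the reciprocal of the binomial coefficient in the eigenvalue.
  have h1 : ((n + k - 1).choose k : ℂ) * k ! * (n - 1)! = (k + n - 1)! := by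
    have := Nat.choose_mul_factorial_mul_factorial (n := n + k - 1) (k := k) (by omega)
    rw [show n + k - 1 - k = n - 1 by omega, show n + k - 1 = k + n - 1 by omega] at this
    rw [show n + k - 1 = k + n - 1 by omega]
    exact_mod_cast this
  have h2 : ((n + k - 1).choose k : ℂ) ≠ 0 := by
    exact_mod_cast (Nat.choose_pos (by omega)).ne'
  have h3 : (k ! : ℂ) ≠ 0 := by exact_mod_cast k.factorial_ne_zero
  have h4 : ((n - 1)! : ℂ) ≠ 0 := by exact_mod_cast (n - 1).factorial_ne_zero
  rw [← h1]
  field_simp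

/-- For a radial symbol `g` with all `g ζ_α` in `L²(ℂⁿ, dμ)`, the convolution `g * q_{1/4}` and the
integrals in the sequence converge absolutely, and `T_g` is bounded if and only if the sequence
is. -/
theorem theorem2p1 (n : ℕ) (hn : 1 ≤ n) (g : (Fin n → ℂ) → ℂ)
    (hmeas : AEMeasurable g volume) (hrad : IsRadial g)
    (hL2 : ∀ α : Fin n → ℕ, MemLp (fun z => g z * fockMonomial α z) 2 (fockMeasure n)) :
    (∀ w : Fin n → ℂ, ConvolutionExistsAt g (heatKernel n (1 / 4)) w
        (ContinuousLinearMap.mul ℂ ℂ) volume) ∧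
      (∀ k : ℕ, Integrable
        (fun w : Fin n → ℂ => heatFlow (1 / 4) g w * laguerreFn n k ((2 : ℂ) • w)) volume) ∧
      (ToeplitzBounded g ↔ ∃ C : ℝ, ∀ k : ℕ, ‖laguerreCoeff g k‖ ≤ C) := by
  have hg : MemLp g 2 (fockMeasure n) := by
    -- The monomial `ζ_0` is the constant `1`.
    have h := hL2 0
    simpa [fockMonomial] using h
  refine ⟨convolutionExistsAt_heatKernel (hg.integrable one_le_two),
    integrable_heatFlow_mul_laguerreFn hg, ?_⟩
  rw [toeplitzBounded_iff hn hrad hL2]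
  have hnorm : ∀ k, ‖laguerreCoeff g k‖ = Real.pi ^ n * ‖toeplitzEigenvalue g k‖ := fun k => by
    rw [laguerreCoeff_eq hn hg, norm_mul, norm_mul]
    simp [abs_of_pos Real.pi_pos]
  have hpi : 0 < Real.pi ^ n := by positivity
  simp only [hnorm]
  constructor
  · rintro ⟨C, hC⟩
    exact ⟨Real.pi ^ n * C, fun k => mul_le_mul_of_nonneg_left (hC k) hpi.le⟩
  · rintro ⟨C, hC⟩
    exact ⟨C / Real.pi ^ n, fun k => (le_div_iff₀' hpi).2 (hC k)⟩
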